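/- Let $\mathcal H$ be a separable complex Hilbert space. A unitary conjugation on $\mathcal H$ is an antilinear bijective isometry $\kappa:\mathcal H\to\mathcal H$ with $\kappa^2=I$. An operator $A$ on $\mathcal H$ (complex linear or antilinear) is diagonal with respect to an orthonormal basis $\{e_n\}$ of $\mathcal H$ if $Ae_n=a_ne_n$ for all $n$, for some complex numbers $a_n$, called its diagonal. For $1<p<\infty$ and a compact complex-linear operator $A$ on $\mathcal H$, let $\|A\|_p=\bigl(\sum_n s_n(A)^p\bigr)^{1/p}\in[0,\infty]$, where $s_n(A)$ are the singular values of $A$, i.e. the eigenvalues of $|A|=(A^*A)^{1/2}$ counted with multiplicity; set $\|A\|_p=\infty$ if $A$ is bounded but not compact. **Proposition.** Let $\tau$ be a unitary conjugation on $\mathcal H$ and let $S$ be a bounded complex-linear operator on $\mathcal H$ that is complex symmetric with respect to $\tau$, i.e. $\tau S^*\tau=S$. Then for every $1<p<\infty$ and every $\varepsilon>0$ there exist a unitary conjugation $\kappa$ on $\mathcal H$, a bounded complex-linear operator $D$ on $\mathcal H$ and an orthonormal basis $\{e_n\}$ of $\mathcal H$ such that $\kappa$ and $D$ are both diagonal with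 respect to $\{e_n\}$, the diagonal of $D$ is non-negative, and $$\| S-\tau D\kappa\|_p<\varepsilon .$$ In particular $S-\tau D\kappa$ is compact. -/

import Mathlib

open scoped ENNReal NNReal

noncomputable section

namespace ComplexSymmetric

/-- An antilinear operator `κ` on `H` is a conjugation if it is an involution, `κ² = I`. -/
def IsConjugation {H : Type*} [NormedAddCommGroup H] [InnerProductSpace ℂ H]
    (κ : H →L⋆[ℂ] H) : Prop :=
  ∀ x, κ (κ x) = x

/-- An antilinear operator is (anti)unitary if it is bijective and norm preserving. -/
def IsAntiunitary {H : Type*} [NormedAddCommGroup H] [InnerProductSpace ℂ H]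
    (κ : H →L⋆[ℂ] H) : Prop :=
  Function.Bijective κ ∧ ∀ x, ‖κ x‖ = ‖x‖

/-- A unitary conjugation: an antilinear, unitary involution of `H`. -/
structure IsUnitaryConjugation {H : Type*} [NormedAddCommGroup H] [InnerProductSpace ℂ H]
    (κ : H →L⋆[ℂ] H) : Prop where
  conjugation : IsConjugation κ
  unitary : IsAntiunitary κ

/-- The bounded complex-linear operator `S` is `τ`-symmetric (complex symmetric with respect to
the unitary conjugation `τ`): `τ S* τ = S`. -/
structure IsComplexSymmetric {H : Type*} [NormedAddCommGroup H] [InnerProductSpace ℂ H]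
    [CompleteSpace H] (τ : H →L⋆[ℂ] H) (S : H →L[ℂ] H) : Prop where
  conjugation : IsUnitaryConjugation τ
  symm : τ.comp ((ContinuousLinearMap.adjoint S).comp τ) = S

/-- The operator `A` (complex linear for `σ = id`, antilinear for `σ = conj`) is diagonal with
respect to the orthonormal basis `e`: `A eₙ = aₙ eₙ` for some complex numbers `aₙ`. -/
def IsDiagonalWrt {H : Type*} [NormedAddCommGroup H] [InnerProductSpace ℂ H] {σ : ℂ →+* ℂ}
    {ι : Type*} (A : H →SL[σ] H) (e : HilbertBasis ι ℂ H) : Prop :=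
  ∃ a : ι → ℂ, ∀ n, A (e n) = a n • e n

/-- `A` is diagonal with respect to the orthonormal basis `e`, with a non-negative diagonal. -/
def IsNonnegDiagonalWrt {H : Type*} [NormedAddCommGroup H] [InnerProductSpace ℂ H] {σ : ℂ →+* ℂ}
    {ι : Type*} (A : H →SL[σ] H) (e : HilbertBasis ι ℂ H) : Prop :=
  ∃ d : ι → ℝ, (∀ n, 0 ≤ d n) ∧ ∀ n, A (e n) = (d n : ℂ) • e n

/-- The multiplicity of `μ ≥ 0` as a singular value of `A`, that is, as an eigenvalue of
`|A| = (A*A)^{1/2}`. (For compact `A` and `μ > 0` the eigenspace is finite dimensional.) -/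
def singularMultiplicity {H : Type*} [NormedAddCommGroup H] [InnerProductSpace ℂ H]
    [CompleteSpace H] (A : H →L[ℂ] H) (μ : ℝ≥0) : ℕ :=
  Module.finrank ℂ (Module.End.eigenspace ((CFC.abs A : H →L[ℂ] H) : H →ₗ[ℂ] H) ((μ : ℝ) : ℂ))

open Classical in
/-- The Schatten norm `‖A‖_p = (∑ₙ sₙ(A)^p)^{1/p}` for `0 < p < ∞`, where the `sₙ(A)` are the
singular values of the compact operator `A`, i.e. the eigenvalues of `|A|`, each repeated
according to its multiplicity: the sum over `n` is written as the sum over the distinct values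
`μ` weighted by their multiplicities. The value is `∞` exactly when `A` is not in the
Schatten class, in particular when `A` is not compact. -/
def schattenNorm {H : Type*} [NormedAddCommGroup H] [InnerProductSpace ℂ H]
    [CompleteSpace H] (p : ℝ) (A : H →L[ℂ] H) : ℝ≥0∞ :=
  if IsCompactOperator A then
    (∑' μ : ℝ≥0, (singularMultiplicity A μ : ℝ≥0∞) * (μ : ℝ≥0∞) ^ p) ^ (1 / p)
  else ∞

end ComplexSymmetric

end

/-! This is a Weyl–von Neumann–Kuroda argument for the antilinear operator `C = τ S`. Complex
symmetry makes `C` symmetric, `⟪C x, y⟫ = ⟪C y, x⟫`, and gives `C² = S*S`. Hence `C` commutes with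
the modulus `A = |S|`, and up to truncation `C = J A` with an antilinear phase `J`. An isometry `τ`
does not affect norms, so it suffices to approximate `C` by an antilinear operator diagonal in some
orthonormal basis; splitting each diagonal entry into phase and modulus turns that operator into `D
κ`.

Cut the spectrum of `A` at the multiples of a mesh `δ`. The span of the vectors `f i`, `E f i`, `J E
f i` (`i < j`, `E` a spectral projection at a grid point) is invariant under `J` times the step
function of `A`, hence under `C` up to `δ`. With `n` grid points its dimension is at most `j (1 +
2n)`. Halving `δ` at each stage gives nested spaces `V j` with dense union
(`exists_almost_invariant`).

By symmetry, `C` nearly preserves the orthogonal complement of `V j` too, so it nearly preserves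
each block `V (j+1) ⊖ V j`. Takagi factorization diagonalizes its compression to a block, and the
remaining error is `O(2⁻ʲ c/m)` on the complement of `V j` (`exists_diagonal_approx`).

So the error has at most `dim V (j+1)`, roughly `j 2ʲ m`, singular values above a threshold of order
`2⁻ʲ/m`. Its `p`-th power sum is at most a constant times `m^(1-p) ∑ (j+1) 2^((1-p)j)`: it converges
and tends to `0` as `m → ∞` exactly because `p > 1` (`schattenNorm_le_of_approx`, `exists_mesh`). -/

noncomputable section
namespace ComplexSymmetric

local notation "⟪" x ", " y "⟫" => inner ℂ x y

/-! ### Spectral projections through the continuous functional calculus -/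

section SpectralProjection

variable {H : Type*} [NormedAddCommGroup H] [InnerProductSpace ℂ H] [CompleteSpace H]

/-- An antilinear operator commuting with a self-adjoint `A` commutes with its real functional
calculus. -/
theorem antilinear_comm_cfc {C : H →L⋆[ℂ] H} {A : H →L[ℂ] H} (hA : IsSelfAdjoint A)
    (h : ∀ x, C (A x) = A (C x)) (f : ℝ → ℝ) (x : H) : C (cfc f A x) = cfc f A (C x) := by
  have hmem : cfc f A ∈ StarAlgebra.elemental ℝ A := cfc_mem_elemental f A
  have key : ∀ T ∈ StarAlgebra.elemental ℝ A,
      (∀ x, C (T x) = T (C x)) ∧ ∀ x, C (star T x) = star T (C x) := by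
    intro T hT
    -- The commutant of `C` is only a real algebra, since `C` conjugates scalars. Asking the same of
    -- `star T` makes it a closed star subalgebra, and it contains `A`.
    let Z : StarSubalgebra ℝ (H →L[ℂ] H) :=
      { carrier := {T | (∀ x, C (T x) = T (C x)) ∧ ∀ x, C (star T x) = star T (C x)}
        mul_mem' := by
          rintro S T ⟨hS, hS'⟩ ⟨hT, hT'⟩
          exact ⟨fun x => by simp [hS, hT], fun x => by simp [star_mul, hS', hT']⟩
        add_mem' := by
          rintro S T ⟨hS, hS'⟩ ⟨hT, hT'⟩
          exact ⟨fun x => by simp [hS, hT], fun x => by simp [star_add, hS', hT']⟩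
        algebraMap_mem' := by
          intro r
          have hr : ∀ x, C ((algebraMap ℝ (H →L[ℂ] H) r) x)
              = (algebraMap ℝ (H →L[ℂ] H) r) (C x) := by
            intro x
            have e : ∀ y : H, (algebraMap ℝ (H →L[ℂ] H) r) y = (r : ℂ) • y := by
              intro y
              simp [Algebra.algebraMap_eq_smul_one]
            rw [e, e, C.map_smulₛₗ, Complex.conj_ofReal]
          refine ⟨hr, ?_⟩
          have : star (algebraMap ℝ (H →L[ℂ] H) r) = algebraMap ℝ (H →L[ℂ] H) r := by
            rw [← algebraMap_star_comm]; simp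
          rw [this]; exact hr
        star_mem' := by
          rintro S ⟨hS, hS'⟩
          exact ⟨hS', by simpa using hS⟩ }
    have hZ : IsClosed (Z : Set (H →L[ℂ] H)) := by
      have : (Z : Set (H →L[ℂ] H)) = (⋂ x, {T | C (T x) = T (C x)}) ∩
          ⋂ x, {T : H →L[ℂ] H | C (star T x) = star T (C x)} := by
        ext T
        simp [Z]
      rw [this]
      refine (isClosed_iInter fun x => ?_).inter (isClosed_iInter fun x => ?_)
      · exact isClosed_eq (by fun_prop) (by fun_prop)
      · exact isClosed_eq (C.continuous.comp ((ContinuousLinearMap.apply ℂ H x).continuous.comp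
          continuous_star)) ((ContinuousLinearMap.apply ℂ H (C x)).continuous.comp continuous_star)
    have hAZ : A ∈ Z := ⟨h, by rw [hA.star_eq]; exact h⟩
    exact StarAlgebra.elemental.le_of_mem hZ hAZ hT
  exact (key _ hmem).1 x

omit [CompleteSpace H] in
theorem starProjection_comm_of_mapsTo {F : Type*} [FunLike F H H] [AddMonoidHomClass F H H]
    (R : F) (K : Submodule ℂ H) [K.HasOrthogonalProjection] (h₁ : ∀ x ∈ K, R x ∈ K)
    (h₂ : ∀ x ∈ Kᗮ, R x ∈ Kᗮ) (x : H) : R (K.starProjection x) = K.starProjection (R x) := by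
  symm
  apply Submodule.eq_starProjection_of_mem_orthogonal (h₁ _ (K.starProjection_apply_mem x))
  rw [← map_sub]
  exact h₂ _ (K.sub_starProjection_mem_orthogonal x)

/-- The positive part `(A - a)⁺`. -/
def posPartAbove (A : H →L[ℂ] H) (a : ℝ) : H →L[ℂ] H := cfc (fun t : ℝ => max (t - a) 0) A

/-- The spectral projection of `A` for the interval `(a, ∞)`. -/
def specProj (A : H →L[ℂ] H) (a : ℝ) : H →L[ℂ] H :=
  (posPartAbove A a).kerᗮ.starProjection

theorem cfc_apply_comm (f g : ℝ → ℝ) (A : H →L[ℂ] H) (x : H) :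
    cfc f A (cfc g A x) = cfc g A (cfc f A x) :=
  congrArg (fun T : H →L[ℂ] H => T x) (cfc_commute_cfc f g A).eq

theorem inner_cfc_left (f : ℝ → ℝ) (A : H →L[ℂ] H) (x y : H) :
    ⟪cfc f A x, y⟫ = ⟪x, cfc f A y⟫ :=
  (ContinuousLinearMap.isSelfAdjoint_iff_isSymmetric.mp (cfc_predicate f A)) x y

theorem specProj_cfc (A : H →L[ℂ] H) (a : ℝ) (f : ℝ → ℝ) (x : H) :
    cfc f A (specProj A a x) = specProj A a (cfc f A x) := by
  have h₁ : ∀ y ∈ (posPartAbove A a).ker, cfc f A y ∈ (posPartAbove A a).ker := by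
    intro y hy
    simp only [LinearMap.mem_ker, ContinuousLinearMap.coe_coe, posPartAbove] at hy ⊢
    rw [cfc_apply_comm, hy, map_zero]
  have h₂ : ∀ y ∈ (posPartAbove A a).kerᗮ, cfc f A y ∈ (posPartAbove A a).kerᗮ := by
    intro y hy z hz
    rw [← inner_cfc_left]
    exact hy _ (h₁ z hz)
  refine starProjection_comm_of_mapsTo (cfc f A) _ h₂ (fun y hy => ?_) x
  rw [Submodule.orthogonal_orthogonal_eq_closure,
    (ContinuousLinearMap.isClosed_ker _).submodule_topologicalClosure_eq] at hy ⊢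
  exact h₁ y hy

/-- Symmetry of `C` plays the role of self-adjointness: since `C` preserves the kernel of `(A -
a)⁺`, it also preserves the orthogonal complement. -/
theorem specProj_antilinear {C : H →L⋆[ℂ] H} (hC : ∀ x y, ⟪C x, y⟫ = ⟪C y, x⟫) {A : H →L[ℂ] H}
    (hA : IsSelfAdjoint A) (h : ∀ x, C (A x) = A (C x)) (a : ℝ) (x : H) :
    C (specProj A a x) = specProj A a (C x) := by
  have h₁ : ∀ y ∈ (posPartAbove A a).ker, C y ∈ (posPartAbove A a).ker := by
    intro y hy
    simp only [LinearMap.mem_ker, ContinuousLinearMap.coe_coe, posPartAbove] at hy ⊢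
    rw [← antilinear_comm_cfc hA h, hy, map_zero]
  have h₂ : ∀ y ∈ (posPartAbove A a).kerᗮ, C y ∈ (posPartAbove A a).kerᗮ := by
    intro y hy
    rw [Submodule.mem_orthogonal']
    intro z hz
    rw [hC]
    exact hy _ (h₁ z hz)
  refine starProjection_comm_of_mapsTo C _ h₂ (fun y hy => ?_) x
  rw [Submodule.orthogonal_orthogonal_eq_closure,
    (ContinuousLinearMap.isClosed_ker _).submodule_topologicalClosure_eq] at hy ⊢
  exact h₁ y hy

/-- A continuous function vanishing on `[a, ∞)` kills the range of the spectral projection. -/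
theorem cfc_specProj_eq_zero {A : H →L[ℂ] H} {a : ℝ} {f : ℝ → ℝ}
    (hf : Continuous f) (h : ∀ t, a ≤ t → f t = 0) (x : H) : cfc f A (specProj A a x) = 0 := by
  have h0 : posPartAbove A a * cfc f A = 0 := by
    rw [posPartAbove, ← cfc_mul _ _ A (by fun_prop) hf.continuousOn]
    have : (fun t : ℝ => max (t - a) 0 * f t) = fun _ => 0 := by
      funext t
      rcases le_total a t with hat | hat
      · simp [h t hat]
      · rw [max_eq_right (by linarith), zero_mul]
    rw [this, cfc_const_zero]
  -- With `E` the projection, `‖f(A) E x‖²` pairs `E x` with `f(A)² E x`; the latter lies in the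
  -- kernel of `(A - a)⁺`, to which `E x` is orthogonal.
  rw [← inner_self_eq_zero (𝕜 := ℂ), inner_cfc_left, ← inner_conj_symm]
  have hk : cfc f A (cfc f A (specProj A a x)) ∈ (posPartAbove A a).ker :=
    congrArg (fun T : H →L[ℂ] H => T (cfc f A (specProj A a x))) h0
  have ho : specProj A a x ∈ (posPartAbove A a).kerᗮ := Submodule.starProjection_apply_mem _ x
  rw [Submodule.inner_right_of_mem_orthogonal hk ho, map_zero]

theorem posPartAbove_apply_sub_specProj (A : H →L[ℂ] H) (a : ℝ) (x : H) :
    posPartAbove A a (x - specProj A a x) = 0 := by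
  have := Submodule.sub_starProjection_mem_orthogonal (K := (posPartAbove A a).kerᗮ) x
  rw [Submodule.orthogonal_orthogonal_eq_closure,
    (ContinuousLinearMap.isClosed_ker _).submodule_topologicalClosure_eq] at this
  exact this

theorem ker_posPartAbove_mono {A : H →L[ℂ] H} {a b : ℝ} (hab : a ≤ b) :
    (posPartAbove A a).ker ≤ (posPartAbove A b).ker := by
  rcases hab.eq_or_lt with rfl | hab
  · exact le_rfl
  intro x hx
  -- `(A - b)⁺` is a continuous function of `A` times `(A - a)⁺`. The cut-off `b - a` keeps the
  -- denominator positive and is inactive where the numerator is nonzero.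
  have hpos : ∀ t : ℝ, 0 < max (t - a) (b - a) := fun t => lt_max_of_lt_right (by linarith)
  have hc : Continuous fun t : ℝ => max (t - b) 0 / max (t - a) (b - a) :=
    Continuous.div (by fun_prop) (by fun_prop) fun t => (hpos t).ne'
  have h0 : posPartAbove A b = cfc (fun t : ℝ => max (t - b) 0 / max (t - a) (b - a)) A *
      posPartAbove A a := by
    rw [posPartAbove, posPartAbove, ← cfc_mul _ _ A hc.continuousOn (by fun_prop)]
    congr 1
    funext t
    rcases le_total b t with h | h
    · have : 0 < t - a := by linarith
      rw [max_eq_left (by linarith : b - a ≤ t - a), max_eq_left this.le, div_mul_cancel₀ _ this.ne']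
    · simp [max_eq_right (by linarith : t - b ≤ 0)]
  simp only [LinearMap.mem_ker, ContinuousLinearMap.coe_coe] at hx ⊢
  rw [h0, mul_apply_eq_comp, hx, map_zero]

theorem specProj_specProj_of_le {A : H →L[ℂ] H} {a b : ℝ} (hab : a ≤ b) (x : H) :
    specProj A a (specProj A b x) = specProj A b x :=
  Submodule.starProjection_eq_self_iff.mpr
    (Submodule.orthogonal_le (ker_posPartAbove_mono hab) (Submodule.starProjection_apply_mem _ x))

theorem specProj_specProj_of_ge {A : H →L[ℂ] H} {a b : ℝ} (hab : a ≤ b) (x : H) :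
    specProj A b (specProj A a x) = specProj A b x := by
  have h := ker_posPartAbove_mono (A := A) hab
  have := Submodule.starProjection_comp_starProjection_of_le (Submodule.orthogonal_le h)
  exact congrArg (fun T : H →L[ℂ] H => T x) this

theorem specProj_specProj (A : H →L[ℂ] H) (a b : ℝ) (x : H) :
    specProj A a (specProj A b x) = specProj A (max a b) x := by
  rcases le_total a b with h | h
  · rw [specProj_specProj_of_le h, max_eq_right h]
  · rw [specProj_specProj_of_ge h, max_eq_left h]

theorem specProj_eq_zero {A : H →L[ℂ] H} {a : ℝ} (ha : ‖A‖ ≤ a) : specProj A a = 0 := by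
  have : posPartAbove A a = 0 := by
    have h : (spectrum ℝ A).EqOn (fun t : ℝ => max (t - a) 0) (fun _ => 0) := by
      intro t ht
      have := spectrum.norm_le_norm_mul_of_mem ht
      have h1 : ‖(1 : H →L[ℂ] H)‖ ≤ 1 := ContinuousLinearMap.norm_id_le
      have h2 : ‖A‖ * ‖(1 : H →L[ℂ] H)‖ ≤ ‖A‖ * 1 := by gcongr
      have := (Real.le_norm_self t).trans this
      exact max_eq_right (by linarith)
    rw [posPartAbove, cfc_congr h, cfc_const_zero]
  ext x
  have hx : specProj A a x ∈ (posPartAbove A a).kerᗮ := Submodule.starProjection_apply_mem _ x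
  simpa [this] using hx

theorem inner_specProj_left (A : H →L[ℂ] H) (a : ℝ) (x y : H) :
    ⟪specProj A a x, y⟫ = ⟪x, specProj A a y⟫ :=
  Submodule.inner_starProjection_left_eq_right _ x y

end SpectralProjection

/-! ### Approximating a self-adjoint operator by a step function -/

section StepApproximation

variable {H : Type*} [NormedAddCommGroup H] [InnerProductSpace ℂ H] [CompleteSpace H]

omit [CompleteSpace H] in
theorem norm_sum_sq_of_pairwise_orthogonal (y : ℕ → H) (n : ℕ)
    (h : ∀ k l, k < l → ⟪y k, y l⟫ = 0) :
    ‖∑ k ∈ Finset.range n, y k‖ ^ 2 = ∑ k ∈ Finset.range n, ‖y k‖ ^ 2 := by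
  induction n with
  | zero => simp
  | succ n ih =>
    rw [Finset.sum_range_succ, Finset.sum_range_succ, ← ih, sq, sq, sq,
      norm_add_sq_eq_norm_sq_add_norm_sq_of_inner_eq_zero (𝕜 := ℂ)]
    rw [sum_inner]
    exact Finset.sum_eq_zero fun k hk => h k n (Finset.mem_range.mp hk)

omit [CompleteSpace H] in
theorem norm_sum_le_of_pairwise_orthogonal {x y : ℕ → H} (n : ℕ) {δ : ℝ} (hδ : 0 ≤ δ)
    (hx : ∀ k l, k < l → ⟪x k, x l⟫ = 0) (hy : ∀ k l, k < l → ⟪y k, y l⟫ = 0)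
    (hxy : ∀ k, ‖y k‖ ≤ δ * ‖x k‖) :
    ‖∑ k ∈ Finset.range n, y k‖ ≤ δ * ‖∑ k ∈ Finset.range n, x k‖ := by
  refine le_of_sq_le_sq ?_ (by positivity)
  rw [mul_pow, norm_sum_sq_of_pairwise_orthogonal y n hy,
    norm_sum_sq_of_pairwise_orthogonal x n hx, Finset.mul_sum]
  refine Finset.sum_le_sum fun k _ => ?_
  rw [← mul_pow]
  exact pow_le_pow_left₀ (norm_nonneg _) (hxy k) 2

/-- The spectral projection of a positive operator for `(kδ, ∞)`, replaced by `1` for `k = 0`. -/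
def gridProj (A : H →L[ℂ] H) (δ : ℝ) (k : ℕ) : H →L[ℂ] H :=
  if k = 0 then 1 else specProj A (k * δ)

theorem gridProj_gridProj (A : H →L[ℂ] H) {δ : ℝ} (hδ : 0 ≤ δ) (k l : ℕ) (x : H) :
    gridProj A δ k (gridProj A δ l x) = gridProj A δ (max k l) x := by
  rcases Nat.eq_zero_or_pos k with rfl | hk
  · simp [gridProj]
  rcases Nat.eq_zero_or_pos l with rfl | hl
  · simp [gridProj]
  have : max k l ≠ 0 := by omega
  simp only [gridProj, hk.ne', hl.ne', this, if_false]
  rw [specProj_specProj, Nat.cast_max, max_mul_of_nonneg _ _ hδ]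

theorem inner_gridProj_left (A : H →L[ℂ] H) (δ : ℝ) (k : ℕ) (x y : H) :
    ⟪gridProj A δ k x, y⟫ = ⟪x, gridProj A δ k y⟫ := by
  unfold gridProj
  split_ifs
  · rfl
  · exact inner_specProj_left _ _ _ _

theorem cfc_gridProj (A : H →L[ℂ] H) (δ : ℝ) (k : ℕ) (f : ℝ → ℝ) (x : H) :
    cfc f A (gridProj A δ k x) = gridProj A δ k (cfc f A x) := by
  unfold gridProj
  split_ifs
  · rfl
  · exact specProj_cfc _ _ _ _

theorem inner_gridProj_sub_eq_zero (A : H →L[ℂ] H) {δ : ℝ} (hδ : 0 ≤ δ) {k l : ℕ} (hkl : k < l)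
    (x y : H) : ⟪gridProj A δ k x - gridProj A δ (k + 1) x,
      gridProj A δ l y - gridProj A δ (l + 1) y⟫ = 0 := by
  simp only [inner_sub_left, inner_sub_right, inner_gridProj_left, gridProj_gridProj A hδ]
  rw [max_eq_right hkl.le, max_eq_right (by omega : k ≤ l + 1), max_eq_right (by omega : k + 1 ≤ l),
    max_eq_right (by omega : k + 1 ≤ l + 1)]
  ring

theorem norm_cfc_max_sub_le_of_posPartAbove_eq_zero {A : H →L[ℂ] H} (hA : IsSelfAdjoint A) {δ : ℝ}
    (hδ : 0 ≤ δ) {x : H} (hx : posPartAbove A δ x = 0) :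
    ‖cfc (fun t : ℝ => max t δ) A x‖ ≤ δ * ‖x‖ := by
  have : cfc (fun t : ℝ => max t δ) A = algebraMap ℝ _ δ + posPartAbove A δ := by
    rw [posPartAbove, ← cfc_const_add δ _ A (by fun_prop) hA]
    congr 1
    funext t
    rcases le_total t δ with h | h
    · simp [h]
    · simp [h]
  rw [this, add_apply, hx, add_zero, Algebra.algebraMap_eq_smul_one]
  simp [norm_smul, abs_of_nonneg hδ]

/-- Such an `x` lies spectrally in `(a, a + δ]`. The function `max t δ - a` splits into `g` with
values in `[0, δ]`, a remainder `r` vanishing on `[a, ∞)`, and `(t - (a + δ))⁺`; the last two kill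
`x`. -/
theorem norm_cfc_max_sub_le {A : H →L[ℂ] H} (hA : IsSelfAdjoint A) {δ a : ℝ} (hδ : 0 ≤ δ)
    (ha : δ ≤ a) {x : H} (hx : posPartAbove A (a + δ) x = 0) (hx' : specProj A a x = x) :
    ‖cfc (fun t : ℝ => max t δ) A x - (a : ℂ) • x‖ ≤ δ * ‖x‖ := by
  let g : ℝ → ℝ := fun t => max (min (t - a) δ) 0
  let r : ℝ → ℝ := fun t => max t δ - a - g t - max (t - (a + δ)) 0
  have hg : Continuous g := by fun_prop
  have hr : Continuous r := by fun_prop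
  have hr0 : cfc r A x = 0 := by
    rw [← hx']
    refine cfc_specProj_eq_zero hr (fun t ht => ?_) x
    simp only [r, g]
    rw [max_eq_left (ha.trans ht), max_eq_left (le_min (by linarith) hδ)]
    rcases le_total t (a + δ) with h | h
    · rw [min_eq_left (by linarith), max_eq_right (by linarith)]; ring
    · rw [min_eq_right (by linarith), max_eq_left (by linarith)]; ring
  have : cfc (fun t : ℝ => max t δ) A
      = algebraMap ℝ _ a + (cfc g A + (cfc r A + posPartAbove A (a + δ))) := by
    rw [posPartAbove, ← cfc_add A r _ hr.continuousOn (by fun_prop),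
      ← cfc_add A g _ hg.continuousOn (by fun_prop), ← cfc_const_add a _ A (by fun_prop) hA]
    congr 1
    funext t
    simp only [r]
    ring
  have hgn : ‖cfc g A‖ ≤ δ := norm_cfc_le hδ fun t _ => by
    rw [Real.norm_of_nonneg (le_max_right _ _)]
    exact max_le (min_le_right _ _) hδ
  rw [this]
  simp only [add_apply, hx, hr0, Algebra.algebraMap_eq_smul_one, add_zero]
  have e : (a • (1 : H →L[ℂ] H)) x = (a : ℂ) • x := by simp
  rw [e, add_sub_cancel_left]
  exact (cfc g A).le_of_opNorm_le hgn x

/-- The step function approximation `δ ⌊A / δ⌋` of a positive operator. -/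
def stepApprox (A : H →L[ℂ] H) (δ : ℝ) (n : ℕ) : H →L[ℂ] H :=
  (δ : ℂ) • ∑ k ∈ Finset.range n, specProj A ((k + 1 : ℕ) * δ)

/-- The scalar estimate is `|max(t, δ) - kδ| ≤ δ` on the `k`-th cell. The cells are mutually
orthogonal, so the bound passes to the sum by Pythagoras with no loss of constant. -/
theorem norm_cfc_max_sub_stepApprox_le {A : H →L[ℂ] H} (hA : IsSelfAdjoint A) {δ : ℝ} (hδ : 0 ≤ δ)
    {n : ℕ} (hn : n ≠ 0) (hnA : ‖A‖ ≤ n * δ) (x : H) :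
    ‖cfc (fun t : ℝ => max t δ) A x - stepApprox A δ n x‖ ≤ δ * ‖x‖ := by
  set M := cfc (fun t : ℝ => max t δ) A with hM
  let E : ℕ → H → H := fun k z => gridProj A δ k z - gridProj A δ (k + 1) z
  have hq : gridProj A δ n = 0 := by
    rw [gridProj, if_neg hn, specProj_eq_zero hnA]
  -- Telescoping from `gridProj` at `0`, which is `1`, so the bottom cell also contains the kernel
  -- of `A`.
  have h1 : ∑ k ∈ Finset.range n, E k x = x := by
    simp only [E]
    rw [Finset.sum_range_sub' (fun k => gridProj A δ k x), hq]
    simp [gridProj]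
  -- Abel summation; the boundary term vanishes at `m = n` by `hq`.
  have h2 : ∀ m : ℕ, ∑ k ∈ Finset.range m, ((k * δ : ℝ) : ℂ) • E k x
      = stepApprox A δ m x - ((m * δ : ℝ) : ℂ) • gridProj A δ m x := by
    intro m
    induction m with
    | zero => simp [stepApprox]
    | succ m ih =>
      have : gridProj A δ (m + 1) = specProj A ((m + 1 : ℕ) * δ) := by simp [gridProj]
      rw [Finset.sum_range_succ, ih]
      simp only [stepApprox, Finset.sum_range_succ, E, this, smul_add,
        add_apply, smul_apply]
      push_cast
      module
  have h3 : M x - stepApprox A δ n x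
      = ∑ k ∈ Finset.range n, (M (E k x) - ((k * δ : ℝ) : ℂ) • E k x) := by
    rw [Finset.sum_sub_distrib, h2, hq, ← map_sum, h1]
    simp
  rw [h3]
  conv_rhs => rw [← h1]
  refine norm_sum_le_of_pairwise_orthogonal n hδ
    (fun k l hkl => inner_gridProj_sub_eq_zero A hδ hkl x x) (fun k l hkl => ?_) (fun k => ?_)
  · have h4 : ∀ k, M (E k x) - ((k * δ : ℝ) : ℂ) • E k x
        = (gridProj A δ k (M x - ((k * δ : ℝ) : ℂ) • x)
          - gridProj A δ (k + 1) (M x - ((k * δ : ℝ) : ℂ) • x)) := by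
      intro k
      simp only [E, map_sub, map_smul, hM, cfc_gridProj, smul_sub]
      abel
    rw [h4, h4]
    exact inner_gridProj_sub_eq_zero A hδ hkl _ _
  · have hE : posPartAbove A ((k + 1 : ℕ) * δ) (E k x) = 0 := by
      have : E k x = gridProj A δ k x - specProj A ((k + 1 : ℕ) * δ) (gridProj A δ k x) := by
        have h5 : gridProj A δ (k + 1) = specProj A ((k + 1 : ℕ) * δ) := by simp [gridProj]
        simp only [E]
        rw [← h5, gridProj_gridProj A hδ, max_eq_left (by omega)]
      rw [this]
      exact posPartAbove_apply_sub_specProj _ _ _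
    rcases Nat.eq_zero_or_pos k with rfl | hk
    · simp only [Nat.cast_zero, zero_mul, Complex.ofReal_zero, zero_smul, sub_zero]
      exact norm_cfc_max_sub_le_of_posPartAbove_eq_zero hA hδ (by simpa using hE)
    · refine norm_cfc_max_sub_le hA hδ ?_ ?_ ?_
      · have : (1 : ℝ) ≤ k := by exact_mod_cast hk
        nlinarith
      · rw [← hE]; push_cast; ring_nf
      · have : specProj A (k * δ) = gridProj A δ k := by simp [gridProj, hk.ne']
        rw [this]
        simp only [E]
        rw [map_sub, gridProj_gridProj A hδ, gridProj_gridProj A hδ, max_self,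
          max_eq_right (by omega)]

end StepApproximation

/-! ### Finite-dimensional subspaces almost invariant under `C` -/

section AlmostInvariantSubspaces

theorem continuous_inv_max {δ : ℝ} (hδ : 0 < δ) : Continuous fun t : ℝ => (max t δ)⁻¹ :=
  Continuous.inv₀ (by fun_prop) fun t => (lt_max_of_lt_right hδ).ne'

variable {H : Type*} [NormedAddCommGroup H] [InnerProductSpace ℂ H] [CompleteSpace H]

omit [CompleteSpace H] in
theorem norm_sub_starProjection_le (V : Submodule ℂ H) [V.HasOrthogonalProjection] (x : H) {y : H}
    (hy : y ∈ V) : ‖x - V.starProjection x‖ ≤ ‖x - y‖ := by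
  have e : x - V.starProjection x = Vᗮ.starProjection (x - y) := by
    rw [Submodule.starProjection_orthogonal_val, map_sub,
      Submodule.starProjection_eq_self_iff.mpr hy]
    abel
  rw [e]
  exact Submodule.norm_starProjection_apply_le _ _

/-- `max(A, δ)⁻¹ C`, a truncation of the antiunitary part of `C = J A`. -/
def truncPhase (C : H →L⋆[ℂ] H) (A : H →L[ℂ] H) (δ : ℝ) : H →L⋆[ℂ] H :=
  (cfc (fun t : ℝ => (max t δ)⁻¹) A).comp C

/-- A symmetric antilinear operator `C` together with its modulus `A = (C²)^{1/2}`. -/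
structure IsModulus (C : H →L⋆[ℂ] H) (A : H →L[ℂ] H) : Prop where
  symm : ∀ x y, ⟪C x, y⟫ = ⟪C y, x⟫
  nonneg : 0 ≤ A
  comm : ∀ x, C (A x) = A (C x)
  sq : ∀ x, C (C x) = A (A x)

namespace IsModulus

variable {C : H →L⋆[ℂ] H} {A : H →L[ℂ] H} (h : IsModulus C A)
include h

theorem isSelfAdjoint : IsSelfAdjoint A := .of_nonneg h.nonneg

theorem norm_apply (x : H) : ‖C x‖ = ‖A x‖ := by
  have hA := ContinuousLinearMap.isSelfAdjoint_iff_isSymmetric.mp h.isSelfAdjoint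
  have : (⟪C x, C x⟫ : ℂ) = ⟪A x, A x⟫ := by
    rw [h.symm, h.sq]
    exact (hA (A x) x)
  rw [← sq_eq_sq₀ (norm_nonneg _) (norm_nonneg _)]
  rw [inner_self_eq_norm_sq_to_K, inner_self_eq_norm_sq_to_K] at this
  exact_mod_cast this

theorem truncPhase_specProj (δ a : ℝ) (x : H) :
    truncPhase C A δ (specProj A a x) = specProj A a (truncPhase C A δ x) := by
  simp only [truncPhase, ContinuousLinearMap.comp_apply]
  rw [specProj_antilinear h.symm h.isSelfAdjoint h.comm, specProj_cfc]

theorem norm_truncPhase_apply_le {δ : ℝ} (hδ : 0 < δ) (x : H) : ‖truncPhase C A δ x‖ ≤ ‖x‖ := by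
  have hc := continuous_inv_max hδ
  simp only [truncPhase, ContinuousLinearMap.comp_apply]
  rw [← antilinear_comm_cfc h.isSelfAdjoint h.comm, h.norm_apply]
  have hA : A * cfc (fun t : ℝ => (max t δ)⁻¹) A = cfc (fun t : ℝ => t * (max t δ)⁻¹) A := by
    rw [cfc_mul (fun t : ℝ => t) _ A (by fun_prop) hc.continuousOn, cfc_id' ℝ A h.isSelfAdjoint]
  have hn : ‖cfc (fun t : ℝ => t * (max t δ)⁻¹) A‖ ≤ 1 := by
    refine norm_cfc_le zero_le_one fun t ht => ?_
    have ht0 : 0 ≤ t := spectrum_nonneg_of_nonneg h.nonneg ht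
    have hm : 0 < max t δ := lt_max_of_lt_right hδ
    rw [Real.norm_of_nonneg (by positivity), ← div_eq_mul_inv, div_le_one hm]
    exact le_max_left _ _
  rw [← mul_apply_eq_comp, hA]
  simpa using ContinuousLinearMap.le_of_opNorm_le _ hn x

/-- The substitute for the polar decomposition: with `max(A, δ)` in place of `A`, the factorization
of `C` is exact and needs no care near the kernel of `A`. -/
theorem truncPhase_cfc_max {δ : ℝ} (hδ : 0 < δ) (x : H) :
    truncPhase C A δ (cfc (fun t : ℝ => max t δ) A x) = C x := by
  have hc := continuous_inv_max hδ
  simp only [truncPhase, ContinuousLinearMap.comp_apply]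
  rw [antilinear_comm_cfc h.isSelfAdjoint h.comm, ← mul_apply_eq_comp,
    ← cfc_mul _ _ A hc.continuousOn (by fun_prop)]
  have : (fun t : ℝ => (max t δ)⁻¹ * max t δ) = fun _ => 1 := by
    funext t
    exact inv_mul_cancel₀ (lt_max_of_lt_right hδ).ne'
  rw [this, cfc_const_one ℝ A h.isSelfAdjoint]
  rfl

/-- Above `a` both truncations are inactive. This is what lets the spaces for successive meshes be
nested although their phases differ. -/
theorem truncPhase_specProj_congr {δ δ' a : ℝ} (hδ' : 0 < δ') (hδ : δ' ≤ δ) (ha : δ ≤ a) (x : H) :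
    truncPhase C A δ (specProj A a x) = truncPhase C A δ' (specProj A a x) := by
  simp only [truncPhase, ContinuousLinearMap.comp_apply]
  rw [specProj_antilinear h.symm h.isSelfAdjoint h.comm, ← sub_eq_zero, ← sub_apply,
    ← cfc_sub _ _ A (continuous_inv_max (hδ'.trans_le hδ)).continuousOn
      (continuous_inv_max hδ').continuousOn]
  refine cfc_specProj_eq_zero ((continuous_inv_max (hδ'.trans_le hδ)).sub
    (continuous_inv_max hδ')) (fun t ht => ?_) _
  simp only [Pi.sub_apply]
  rw [max_eq_left (ha.trans ht), max_eq_left (hδ.trans (ha.trans ht)), sub_self]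

/-- The square of the truncated phase is `max(A, δ)⁻² A²`, a function of `A` equal to `1` on `[a,
∞)`. -/
theorem truncPhase_truncPhase_specProj {δ a : ℝ} (hδ : 0 < δ) (ha : δ ≤ a) (x : H) :
    truncPhase C A δ (truncPhase C A δ (specProj A a x)) = specProj A a x := by
  have hc := continuous_inv_max hδ
  have e : cfc (fun t : ℝ => (max t δ)⁻¹ * ((max t δ)⁻¹ * (t * t)) - 1) A
      = cfc (fun t : ℝ => (max t δ)⁻¹) A * (cfc (fun t : ℝ => (max t δ)⁻¹) A * (A * A)) - 1 := by
    rw [cfc_sub _ _ A (by fun_prop) (by fun_prop), cfc_const_one ℝ A h.isSelfAdjoint,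
      cfc_mul _ _ A hc.continuousOn (by fun_prop), cfc_mul _ _ A hc.continuousOn (by fun_prop),
      cfc_mul (fun t : ℝ => t) _ A (by fun_prop) (by fun_prop), cfc_id' ℝ A h.isSelfAdjoint]
  have h0 := cfc_specProj_eq_zero (A := A) (a := a)
    (f := fun t : ℝ => (max t δ)⁻¹ * ((max t δ)⁻¹ * (t * t)) - 1) (by fun_prop) (fun t ht => by
      have : 0 < t := hδ.trans_le (ha.trans ht)
      rw [max_eq_left (ha.trans ht)]
      field_simp
      ring) x
  rw [e, sub_apply, sub_eq_zero] at h0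
  rw [one_apply_eq_self] at h0
  conv_rhs => rw [← h0]
  simp only [truncPhase, ContinuousLinearMap.comp_apply, mul_apply_eq_comp]
  rw [antilinear_comm_cfc h.isSelfAdjoint h.comm, h.sq]

end IsModulus

/-- Generators of the approximately `C`-invariant subspaces. -/
def approxGen (C : H →L⋆[ℂ] H) (A : H →L[ℂ] H) (δ : ℝ) (n : ℕ) (f : ℕ → H) (j : ℕ) :
    Fin j × (Unit ⊕ Fin n ⊕ Fin n) → H
  | (i, .inl _) => f i
  | (i, .inr (.inl k)) => specProj A ((k + 1 : ℕ) * δ) (f i)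
  | (i, .inr (.inr k)) => truncPhase C A δ (specProj A ((k + 1 : ℕ) * δ) (f i))

/-- The span of the vectors `f i`, `E f i`, `J E f i` for `i < j`, where `E` runs through the
spectral projections of `A` for `(kδ, ∞)`, `1 ≤ k ≤ n`. -/
def approxSpace (C : H →L⋆[ℂ] H) (A : H →L[ℂ] H) (δ : ℝ) (n : ℕ) (f : ℕ → H) (j : ℕ) :
    Submodule ℂ H := Submodule.span ℂ (Set.range (approxGen C A δ n f j))

instance (C : H →L⋆[ℂ] H) (A : H →L[ℂ] H) (δ : ℝ) (n : ℕ) (f : ℕ → H) (j : ℕ) :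
    FiniteDimensional ℂ (approxSpace C A δ n f j) :=
  FiniteDimensional.span_of_finite ℂ (Set.finite_range _)

theorem finrank_approxSpace_le (C : H →L⋆[ℂ] H) (A : H →L[ℂ] H) (δ : ℝ) (n : ℕ) (f : ℕ → H)
    (j : ℕ) : Module.finrank ℂ (approxSpace C A δ n f j) ≤ j * (1 + 2 * n) := by
  refine (finrank_range_le_card (R := ℂ) (approxGen C A δ n f j)).trans_eq ?_
  simp [two_mul]

theorem approxGen_mem (C : H →L⋆[ℂ] H) (A : H →L[ℂ] H) (δ : ℝ) (n : ℕ) (f : ℕ → H) {j i : ℕ}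
    (hi : i < j) : f i ∈ approxSpace C A δ n f j :=
  Submodule.subset_span ⟨(⟨i, hi⟩, .inl ()), rfl⟩

theorem specProj_mem_approxSpace (C : H →L⋆[ℂ] H) (A : H →L[ℂ] H) (δ : ℝ) {n : ℕ} (f : ℕ → H)
    {j i k : ℕ} (hi : i < j) (hk : k < n) :
    specProj A ((k + 1 : ℕ) * δ) (f i) ∈ approxSpace C A δ n f j :=
  Submodule.subset_span ⟨(⟨i, hi⟩, .inr (.inl ⟨k, hk⟩)), rfl⟩

theorem truncPhase_mem_approxSpace (C : H →L⋆[ℂ] H) (A : H →L[ℂ] H) (δ : ℝ) {n : ℕ} (f : ℕ → H)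
    {j i k : ℕ} (hi : i < j) (hk : k < n) :
    truncPhase C A δ (specProj A ((k + 1 : ℕ) * δ) (f i)) ∈ approxSpace C A δ n f j :=
  Submodule.subset_span ⟨(⟨i, hi⟩, .inr (.inr ⟨k, hk⟩)), rfl⟩

namespace IsModulus

variable {C : H →L⋆[ℂ] H} {A : H →L[ℂ] H} (h : IsModulus C A)
include h

/-- Every grid point of mesh `δ` is one of mesh `δ / 2`: `(k + 1) δ = (2k + 2)(δ / 2)`. -/
theorem approxSpace_le {δ : ℝ} (hδ : 0 < δ) (n : ℕ) (f : ℕ → H) {j j' : ℕ} (hj : j ≤ j') :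
    approxSpace C A δ n f j ≤ approxSpace C A (δ / 2) (2 * n) f j' := by
  rw [approxSpace, Submodule.span_le]
  rintro _ ⟨⟨i, _ | k | k⟩, rfl⟩
  · exact approxGen_mem _ _ _ _ _ (i.2.trans_le hj)
  all_goals
    have e : ((k + 1 : ℕ) : ℝ) * δ = ((2 * k + 1 + 1 : ℕ) : ℝ) * (δ / 2) := by push_cast; ring
  · simp only [approxGen, e]
    exact specProj_mem_approxSpace _ _ _ _ (i.2.trans_le hj) (by omega)
  · have ha : δ ≤ ((k + 1 : ℕ) : ℝ) * δ := by
      push_cast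
      have : (0 : ℝ) ≤ (k : ℕ) := Nat.cast_nonneg _
      nlinarith
    simp only [approxGen]
    rw [h.truncPhase_specProj_congr (half_pos hδ) (half_le_self hδ.le) ha, e]
    exact truncPhase_mem_approxSpace _ _ _ _ (i.2.trans_le hj) (by omega)

omit h in
theorem truncPhase_stepApprox (δ : ℝ) (n : ℕ) (x : H) :
    truncPhase C A δ (stepApprox A δ n x)
      = (δ : ℂ) • ∑ k ∈ Finset.range n, truncPhase C A δ (specProj A ((k + 1 : ℕ) * δ) x) := by
  rw [stepApprox, smul_apply, ContinuousLinearMap.map_smulₛₗ, Complex.conj_ofReal,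
    sum_apply, map_sum]

/-- The generators are permuted up to relabelling: products of grid projections are grid
projections, the phase commutes with them, and it squares to the identity on their ranges. -/
theorem truncPhase_stepApprox_mem {δ : ℝ} (hδ : 0 < δ) (n : ℕ) (f : ℕ → H) (j : ℕ) {x : H}
    (hx : x ∈ approxSpace C A δ n f j) :
    truncPhase C A δ (stepApprox A δ n x) ∈ approxSpace C A δ n f j := by
  have hmax : ∀ (k l : ℕ) (y : H), specProj A ((k + 1 : ℕ) * δ) (specProj A ((l + 1 : ℕ) * δ) y)
      = specProj A ((max k l + 1 : ℕ) * δ) y := by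
    intro k l y
    rw [specProj_specProj, ← max_mul_of_nonneg _ _ hδ.le, ← Nat.cast_max]
    congr 4
    omega
  refine Submodule.span_induction ?_ ?_ ?_ ?_ hx
  · rintro _ ⟨⟨i, _ | l | l⟩, rfl⟩
    all_goals
      rw [truncPhase_stepApprox]
      refine Submodule.smul_mem _ _ (Submodule.sum_mem _ fun k hk => ?_)
      have hk := Finset.mem_range.mp hk
      simp only [approxGen]
    · exact truncPhase_mem_approxSpace _ _ _ _ i.2 hk
    · rw [hmax]
      exact truncPhase_mem_approxSpace _ _ _ _ i.2 (max_lt hk l.2)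
    · rw [← h.truncPhase_specProj, hmax, h.truncPhase_truncPhase_specProj hδ]
      · exact specProj_mem_approxSpace _ _ _ _ i.2 (max_lt hk l.2)
      · push_cast
        have : (0 : ℝ) ≤ max (k : ℝ) (l : ℕ) := le_max_of_le_left (Nat.cast_nonneg _)
        nlinarith
  · simp
  · intro x y _ _ hx hy
    simpa using Submodule.add_mem _ hx hy
  · intro a x _ hx
    simpa [ContinuousLinearMap.map_smulₛₗ] using Submodule.smul_mem _ _ hx

/-- `approxSpace` is invariant under `C` up to an error `δ`. -/
theorem norm_sub_starProjection_approxSpace_le {δ : ℝ} (hδ : 0 < δ) {n : ℕ} (hn : n ≠ 0)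
    (hnA : ‖A‖ ≤ n * δ) (f : ℕ → H) (j : ℕ) {x : H} (hx : x ∈ approxSpace C A δ n f j) :
    ‖C x - (approxSpace C A δ n f j).starProjection (C x)‖ ≤ δ * ‖x‖ := by
  have hmem := h.truncPhase_stepApprox_mem hδ n f j hx
  refine (norm_sub_starProjection_le _ _ hmem).trans ?_
  -- The phase is a contraction, so the error is that of replacing `max(A, δ)` by the step function.
  rw [← h.truncPhase_cfc_max hδ x, ← map_sub]
  exact (h.norm_truncPhase_apply_le hδ _).trans
    (norm_cfc_max_sub_stepApprox_le h.isSelfAdjoint hδ.le hn hnA x)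

/-- A symmetric antilinear operator has an increasing sequence of almost invariant
finite-dimensional subspaces with dense union and controlled dimensions. -/
theorem exists_almost_invariant {c : ℝ} (hc : 0 < c) (hcA : ‖A‖ ≤ c) {m : ℕ} (hm : m ≠ 0)
    (f : ℕ → H) : ∃ V : ℕ → Submodule ℂ H, Monotone V ∧ V 0 = ⊥ ∧ (∀ i, f i ∈ V (i + 1)) ∧
      (∀ j, FiniteDimensional ℂ (V j)) ∧
      (∀ j, Module.finrank ℂ (V j) ≤ j * (1 + 2 * (2 ^ j * m))) ∧
      ∀ j, ∀ x ∈ V j, ∃ y ∈ V j, ‖C x - y‖ ≤ c / m / 2 ^ j * ‖x‖ := by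
  have hm' : (0 : ℝ) < m := by exact_mod_cast Nat.pos_of_ne_zero hm
  -- Mesh times number of grid points is always `c ≥ ‖A‖`, so the grid covers the spectrum. Only `f
  -- i` with `i < j` are used, whence `V 0 = ⊥`.
  refine ⟨fun j => approxSpace C A (c / m / 2 ^ j) (2 ^ j * m) f j, ?_, ?_, ?_, ?_, ?_, ?_⟩
  · refine monotone_nat_of_le_succ fun j => ?_
    have := h.approxSpace_le (δ := c / m / 2 ^ j) (by positivity) (2 ^ j * m) f (Nat.le_succ j)
    convert! this using 2
    · rw [pow_succ]; field_simp
    · rw [pow_succ]; ring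
  · simp [approxSpace]
  · exact fun i => approxGen_mem _ _ _ _ _ (Nat.lt_succ_self i)
  · exact fun j => inferInstance
  · exact fun j => finrank_approxSpace_le _ _ _ _ _ _
  · intro j x hx
    refine ⟨_, Submodule.starProjection_apply_mem _ _,
      h.norm_sub_starProjection_approxSpace_le (by positivity) (by positivity) ?_ f j hx⟩
    refine hcA.trans_eq ?_
    push_cast
    field_simp

end IsModulus

end AlmostInvariantSubspaces

/-! ### Takagi factorization and orthogonal complements -/

section FiniteDimensional

variable {H : Type*} [NormedAddCommGroup H] [InnerProductSpace ℂ H]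

section Takagi

variable {T : H →ₗ⋆[ℂ] H} (hT : ∀ x y, ⟪T x, y⟫ = ⟪T y, x⟫)
include hT

/-- A symmetric antilinear operator has a unit eigenvector in every nonzero invariant
finite-dimensional subspace. -/
theorem exists_unit_eigenvector {W : Submodule ℂ H} [FiniteDimensional ℂ W]
    (hW : ∀ x ∈ W, T x ∈ W) (hW0 : W ≠ ⊥) : ∃ x ∈ W, ‖x‖ = 1 ∧ ∃ c : ℂ, T x = c • x := by
  suffices h : ∃ x ∈ W, x ≠ 0 ∧ ∃ r : ℝ, T x = (r : ℂ) • x by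
    obtain ⟨x, hx, hx0, r, hr⟩ := h
    have hn : (‖x‖ : ℂ) ≠ 0 := by simpa using hx0
    refine ⟨((‖x‖⁻¹ : ℝ) : ℂ) • x, W.smul_mem _ hx, ?_, r, ?_⟩
    · rw [norm_smul, Complex.norm_real, norm_inv, norm_norm, inv_mul_cancel₀ (by simpa using hx0)]
    · rw [map_smulₛₗ, Complex.conj_ofReal, hr, smul_comm]
  have : Nontrivial W := Submodule.nontrivial_iff_ne_bot.mpr hW0
  let T2 : Module.End ℂ W := LinearMap.restrict (T.comp T : H →ₗ[ℂ] H) fun x hx => hW _ (hW x hx)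
  obtain ⟨μ, hμ⟩ := Module.End.exists_eigenvalue T2
  obtain ⟨w, hw⟩ := hμ.exists_hasEigenvector
  have hw0 : (w : H) ≠ 0 := by simpa using hw.2
  have hTT : T (T w) = μ • (w : H) := congrArg Subtype.val hw.apply_eq_smul
  set r : ℝ := ‖T w‖ / ‖(w : H)‖ with hr
  have hμr : μ = (r : ℂ) * r := by
    have h1 : ⟪T w, T w⟫ = (starRingEnd ℂ) μ * ⟪(w : H), (w : H)⟫ := by
      rw [hT, hTT, inner_smul_left]
    rw [inner_self_eq_norm_sq_to_K, inner_self_eq_norm_sq_to_K] at h1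
    have hn : ((‖(w : H)‖ : ℝ) : ℂ) ≠ 0 := by simpa using hw0
    have h2 : (starRingEnd ℂ) μ = (r : ℂ) * r := by
      rw [hr]
      push_cast
      field_simp
      exact h1.symm
    rw [← Complex.conj_conj μ, h2, map_mul, Complex.conj_ofReal]
  -- Since `T² w = r² w` with `r` real, `T w + r w` is an eigenvector for `r` unless it vanishes,
  -- and then `w` is one for `-r`.
  by_cases hy : T w + (r : ℂ) • (w : H) = 0
  · refine ⟨w, w.2, hw0, -r, ?_⟩
    rw [eq_neg_of_add_eq_zero_left hy]
    simp
  · refine ⟨T w + (r : ℂ) • (w : H), W.add_mem (hW _ w.2) (W.smul_mem _ w.2), hy, r, ?_⟩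
    rw [map_add, map_smulₛₗ, Complex.conj_ofReal, hTT, hμr]
    module

/-- Takagi factorization: a symmetric antilinear operator on a finite-dimensional space has an
orthonormal basis of eigenvectors. -/
theorem exists_orthonormalBasis_eigenvectors [FiniteDimensional ℂ H] :
    ∃ (b : OrthonormalBasis (Fin (Module.finrank ℂ H)) ℂ H)
      (c : Fin (Module.finrank ℂ H) → ℂ), ∀ i, T (b i) = c i • b i := by
  have key : ∀ k ≤ Module.finrank ℂ H, ∃ v : Fin k → H, Orthonormal ℂ v ∧
      ∀ i, ∃ c : ℂ, T (v i) = c • v i := by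
    intro k
    induction k with
    | zero => exact fun _ => ⟨Fin.elim0, by simp [Orthonormal], fun i => i.elim0⟩
    | succ k ih =>
      intro hk
      obtain ⟨v, hv, hvT⟩ := ih (by omega)
      let W := (Submodule.span ℂ (Set.range v))ᗮ
      have hWmem : ∀ x, x ∈ W ↔ ∀ i, ⟪v i, x⟫ = 0 := by
        intro x
        rw [Submodule.mem_orthogonal]
        refine ⟨fun h i => h _ (Submodule.subset_span ⟨i, rfl⟩), fun h u hu => ?_⟩
        refine Submodule.span_induction (p := fun u _ => ⟪u, x⟫ = 0) ?_ ?_ ?_ ?_ hu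
        · rintro _ ⟨i, rfl⟩
          exact h i
        · simp
        · intro a b _ _ ha hb
          rw [inner_add_left, ha, hb, add_zero]
        · intro a b _ hb
          rw [inner_smul_left, hb, mul_zero]
      -- Symmetry keeps the complement of eigenvectors invariant, so the induction can continue
      -- inside it.
      have hW : ∀ x ∈ W, T x ∈ W := by
        intro x hx
        rw [hWmem] at hx ⊢
        intro i
        obtain ⟨c, hc⟩ := hvT i
        rw [← inner_conj_symm, hT, hc, inner_smul_left, hx i]
        simp
      have hW0 : W ≠ ⊥ := by
        intro h0
        have h1 := Submodule.finrank_add_finrank_orthogonal (Submodule.span ℂ (Set.range v))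
        have h2 : Module.finrank ℂ (Submodule.span ℂ (Set.range v)) ≤ k :=
          (finrank_range_le_card (R := ℂ) v).trans_eq (Fintype.card_fin k)
        change _ + Module.finrank ℂ W = _ at h1
        rw [h0, finrank_bot] at h1
        omega
      obtain ⟨x, hx, hx1, c, hc⟩ := exists_unit_eigenvector hT hW hW0
      rw [hWmem] at hx
      refine ⟨Fin.snoc v x, ?_, ?_⟩
      · constructor
        · intro i
          refine Fin.lastCases ?_ (fun i => ?_) i
          · simpa using hx1
          · simpa using hv.1 i
        · intro i j
          refine Fin.lastCases ?_ (fun i => ?_) i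
          · refine Fin.lastCases (fun h => absurd rfl h) (fun j _ => ?_) j
            simpa using inner_eq_zero_symm.mp (hx j)
          · refine Fin.lastCases (fun _ => by simpa using hx i) (fun j hij => ?_) j
            simpa using hv.2 (fun h => hij (congrArg _ h))
      · intro i
        refine Fin.lastCases ⟨c, by simpa using hc⟩ (fun i => ?_) i
        simpa using hvT i
  obtain ⟨v, hv, hvT⟩ := key _ le_rfl
  choose c hc using hvT
  refine ⟨OrthonormalBasis.mk hv
    (hv.linearIndependent.span_eq_top_of_card_eq_finrank' (by simp)).ge, c, fun i => ?_⟩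
  simpa using hc i

end Takagi

theorem starProjection_inf_orthogonal {V V' : Submodule ℂ H} (hVV' : V ≤ V')
    [V.HasOrthogonalProjection] [V'.HasOrthogonalProjection]
    [(V' ⊓ Vᗮ).HasOrthogonalProjection] (x : H) :
    (V' ⊓ Vᗮ).starProjection x = V'.starProjection x - V.starProjection x := by
  apply Submodule.eq_starProjection_of_mem_orthogonal
  · refine ⟨V'.sub_mem (V'.starProjection_apply_mem x) (hVV' (V.starProjection_apply_mem x)), ?_⟩
    have := Vᗮ.sub_mem (V.sub_starProjection_mem_orthogonal x)
      (Submodule.orthogonal_le hVV' (V'.sub_starProjection_mem_orthogonal x))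
    simpa using this
  · have h1 := Submodule.orthogonal_le (inf_le_left : V' ⊓ Vᗮ ≤ V')
      (V'.sub_starProjection_mem_orthogonal x)
    have h2 := Submodule.orthogonal_le (inf_le_right : V' ⊓ Vᗮ ≤ Vᗮ)
      (V.le_orthogonal_orthogonal (V.starProjection_apply_mem x))
    have := Submodule.add_mem _ h1 h2
    convert! this using 1
    abel

/-- If a finite-dimensional subspace is invariant under a symmetric antilinear operator up to an
error `δ`, then so is its orthogonal complement. -/
theorem norm_starProjection_le_of_mem_orthogonal {C : H →L⋆[ℂ] H}
    (hC : ∀ x y, ⟪C x, y⟫ = ⟪C y, x⟫) {V : Submodule ℂ H} [V.HasOrthogonalProjection] {δ : ℝ}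
    (hδ : 0 ≤ δ) (hV : ∀ x ∈ V, ∃ y ∈ V, ‖C x - y‖ ≤ δ * ‖x‖) {x : H} (hx : x ∈ Vᗮ) :
    ‖V.starProjection (C x)‖ ≤ δ * ‖x‖ := by
  set z := V.starProjection (C x) with hz
  have hzV : z ∈ V := V.starProjection_apply_mem _
  obtain ⟨y, hy, hzy⟩ := hV z hzV
  -- By symmetry `‖z‖² = ⟪C x, z⟫ = ⟪C z, x⟫`, and the approximant `y ∈ V` of `C z` is orthogonal to
  -- `x`.
  have h1 : ⟪z, z⟫ = ⟪C z - y, x⟫ := by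
    rw [inner_sub_left, hx y hy, sub_zero, ← hC]
    have h2 : ⟪C x - z, z⟫ = 0 := V.starProjection_inner_eq_zero _ _ hzV
    rw [inner_sub_left, sub_eq_zero] at h2
    exact h2.symm
  have h3 : ‖z‖ * ‖z‖ ≤ δ * ‖z‖ * ‖x‖ := by
    have h4 : ‖⟪z, z⟫‖ = ‖z‖ * ‖z‖ := by
      rw [inner_self_eq_norm_sq_to_K]
      simp [sq]
    rw [← h4, h1]
    exact (norm_inner_le_norm _ _).trans (by gcongr)
  rcases (norm_nonneg z).eq_or_lt with h0 | h0
  · rw [← h0]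
    positivity
  · nlinarith

end FiniteDimensional

/-! ### Singular values and finite-rank approximation -/

section SchattenNorm

variable {H : Type*} [NormedAddCommGroup H] [InnerProductSpace ℂ H] [CompleteSpace H]

theorem norm_abs_apply (T : H →L[ℂ] H) (x : H) : ‖(CFC.abs T : H →L[ℂ] H) x‖ = ‖T x‖ := by
  have hA := ContinuousLinearMap.isSelfAdjoint_iff_isSymmetric.mp
    (IsSelfAdjoint.of_nonneg (CFC.abs_nonneg T))
  have h : (CFC.abs T : H →L[ℂ] H) (CFC.abs T x) = ContinuousLinearMap.adjoint T (T x) := by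
    rw [← mul_apply_eq_comp, CFC.abs_mul_abs]
    rfl
  have : (⟪CFC.abs T x, CFC.abs T x⟫ : ℂ) = ⟪T x, T x⟫ := by
    rw [← ContinuousLinearMap.adjoint_inner_right T, ← h]
    exact hA x _
  rw [← sq_eq_sq₀ (norm_nonneg _) (norm_nonneg _)]
  rw [inner_self_eq_norm_sq_to_K, inner_self_eq_norm_sq_to_K] at this
  exact_mod_cast this

/-- The eigenspace of `|T|` at `μ`. -/
abbrev absEigenspace (T : H →L[ℂ] H) (μ : ℝ≥0) : Submodule ℂ H :=
  Module.End.eigenspace ((CFC.abs T : H →L[ℂ] H) : H →ₗ[ℂ] H) ((μ : ℝ) : ℂ)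

theorem orthogonalFamily_absEigenspace (T : H →L[ℂ] H) (s : Finset ℝ≥0) :
    OrthogonalFamily ℂ (fun μ : s => absEigenspace T μ) fun μ => (absEigenspace T μ).subtypeₗᵢ := by
  have hA := ContinuousLinearMap.isSelfAdjoint_iff_isSymmetric.mp
    (IsSelfAdjoint.of_nonneg (CFC.abs_nonneg T))
  exact hA.orthogonalFamily_eigenspaces.comp (γ := s) (f := fun μ : s => (((μ : ℝ≥0) : ℝ) : ℂ))
    fun a b hab => Subtype.ext (NNReal.coe_injective (Complex.ofReal_injective hab))

/-- If `T = F + G` with `‖G‖ ≤ t`, then at most `rank F` singular values of `T` exceed `t`. -/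
theorem sum_singularMultiplicity_le {T F G : H →L[ℂ] H} (hT : T = F + G) {t : ℝ≥0}
    (hG : ∀ x, ‖G x‖ ≤ t * ‖x‖) [FiniteDimensional ℂ F.range] (s : Finset ℝ≥0)
    (hs : ∀ μ ∈ s, t < μ) :
    ∑ μ ∈ s, singularMultiplicity T μ ≤ Module.finrank ℂ F.range := by
  have hV := orthogonalFamily_absEigenspace T s
  let Φ : (∀ μ : s, absEigenspace T μ) →ₗ[ℂ] F.range :=
    (F : H →ₗ[ℂ] H).rangeRestrict ∘ₗ
      ∑ μ : s, (absEigenspace T μ).subtype ∘ₗ LinearMap.proj μ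
  -- If `F x = 0` then `‖T x‖ = ‖G x‖ ≤ t ‖x‖`, whereas a nonzero `x` in the sum of eigenspaces with
  -- `μ > t` satisfies `‖T x‖ > t ‖x‖`. So `F` is injective on that sum.
  have hΦ : Function.Injective Φ := by
    rw [← LinearMap.ker_eq_bot, LinearMap.ker_eq_bot']
    intro v hv
    have hF : F (∑ μ : s, (v μ : H)) = 0 := by
      have := congrArg (fun z : F.range => (z : H)) hv
      simpa [Φ] using this
    set x : H := ∑ μ : s, (v μ : H) with hx
    have h1 : ‖x‖ ^ 2 = ∑ μ : s, ‖v μ‖ ^ 2 := hV.norm_sum v Finset.univ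
    have h2 : ‖T x‖ ^ 2 = ∑ μ : s, ((μ : ℝ≥0) : ℝ) ^ 2 * ‖v μ‖ ^ 2 := by
      have e : (CFC.abs T : H →L[ℂ] H) x
          = ∑ μ : s, (absEigenspace T μ).subtypeₗᵢ ((((μ : ℝ≥0) : ℝ) : ℂ) • v μ) := by
        rw [hx, map_sum]
        refine Finset.sum_congr rfl fun μ _ => ?_
        exact Module.End.mem_eigenspace_iff.mp (v μ).2
      rw [← norm_abs_apply, e, hV.norm_sum]
      refine Finset.sum_congr rfl fun μ _ => ?_
      rw [norm_smul, mul_pow]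
      simp
    have h3 : ‖T x‖ ^ 2 ≤ (t : ℝ) ^ 2 * ‖x‖ ^ 2 := by
      rw [← mul_pow, hT, add_apply, hF, zero_add]
      exact pow_le_pow_left₀ (norm_nonneg _) (hG x) 2
    have h4 : ∑ μ : s, ((((μ : ℝ≥0) : ℝ) ^ 2 - (t : ℝ) ^ 2) * ‖v μ‖ ^ 2) ≤ 0 := by
      simp only [sub_mul, Finset.sum_sub_distrib, ← Finset.mul_sum]
      rw [← h2, ← h1]
      linarith
    have hpos : ∀ μ : s, 0 < ((μ : ℝ≥0) : ℝ) ^ 2 - (t : ℝ) ^ 2 := fun μ => by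
      have : (t : ℝ) < (μ : ℝ≥0) := hs μ μ.2
      have := t.coe_nonneg
      nlinarith
    have h5 := (Finset.sum_eq_zero_iff_of_nonneg fun μ _ =>
      mul_nonneg (hpos μ).le (sq_nonneg ‖v μ‖)).mp
      (le_antisymm h4 (Finset.sum_nonneg fun μ _ => mul_nonneg (hpos μ).le (sq_nonneg ‖v μ‖)))
    funext μ
    have := h5 μ (Finset.mem_univ _)
    simpa [(hpos μ).ne'] using this
  have hfin : FiniteDimensional ℂ (∀ μ : s, absEigenspace T μ) := Module.Finite.of_injective Φ hΦ
  have hfin' : ∀ μ : s, FiniteDimensional ℂ (absEigenspace T μ) := fun μ =>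
    Module.Finite.of_surjective (LinearMap.proj (R := ℂ) (φ := fun μ : s => absEigenspace T μ) μ)
      (LinearMap.proj_surjective μ)
  have := LinearMap.finrank_le_finrank_of_injective hΦ
  rw [Module.finrank_pi_fintype] at this
  rw [← Finset.sum_coe_sort]
  exact this

theorem isCompactOperator_of_approx {T : H →L[ℂ] H} {F G : ℕ → H →L[ℂ] H} {t : ℕ → ℝ}
    (hT : ∀ j, T = F j + G j) (hF : ∀ j, FiniteDimensional ℂ (F j).range)
    (hG : ∀ j, ‖G j‖ ≤ t j) (ht : Filter.Tendsto t Filter.atTop (nhds 0)) :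
    IsCompactOperator T := by
  have hlim : Filter.Tendsto F Filter.atTop (nhds T) := by
    rw [tendsto_iff_norm_sub_tendsto_zero]
    refine squeeze_zero (fun _ => norm_nonneg _) (fun j => ?_) ht
    rw [norm_sub_rev, hT j, add_sub_cancel_left]
    exact hG j
  refine isCompactOperator_of_tendsto hlim (Filter.Eventually.of_forall fun j => ?_)
  have := FiniteDimensional.proper ℂ (F j).range
  have hsub : IsCompactOperator (Submodule.subtypeL (F j).range) :=
    isCompactOperator_of_locallyCompactSpace_rng _
  exact hsub.comp_clm ((F j).codRestrict (F j).range fun x => LinearMap.mem_range_self _ x)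

/-- A bound for the Schatten norm in terms of approximation by operators of finite rank. -/
theorem schattenNorm_le_of_approx {T : H →L[ℂ] H} {F G : ℕ → H →L[ℂ] H} {t : ℕ → ℝ≥0} {N : ℕ → ℕ}
    (hT : ∀ j, T = F j + G j) (hF : ∀ j, FiniteDimensional ℂ (F j).range)
    (hN : ∀ j, Module.finrank ℂ (F j).range ≤ N j) (hN0 : N 0 = 0)
    (hG : ∀ j, ‖G j‖ ≤ t j) (ht : Filter.Tendsto t Filter.atTop (nhds 0)) {p : ℝ}
    (hp : 0 < p) :
    schattenNorm p T ≤ (∑' j, (N (j + 1) : ℝ≥0∞) * (t j : ℝ≥0∞) ^ p) ^ (1 / p) := by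
  have hcount : ∀ j (s : Finset ℝ≥0), (∀ μ ∈ s, t j < μ) →
      ∑ μ ∈ s, singularMultiplicity T μ ≤ N j := fun j s hs =>
    (sum_singularMultiplicity_le (hT j) (fun x => (G j).le_of_opNorm_le (hG j) x) s hs).trans (hN j)
  have hcompact : IsCompactOperator T :=
    isCompactOperator_of_approx hT hF hG (by simpa using (NNReal.tendsto_coe.mpr ht))
  rw [schattenNorm, if_pos hcompact]
  refine ENNReal.rpow_le_rpow ?_ (by positivity)
  -- Layer `j` holds at most `N (j + 1)` singular values, each at most `t j`; hence the index shift
  -- in the bound. Nothing lies above `t 0` because `N 0 = 0`.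
  let S : ℕ → Set ℝ≥0 := fun j => {μ | t (j + 1) < μ ∧ μ ≤ t j}
  have hpt : ∀ μ : ℝ≥0, (singularMultiplicity T μ : ℝ≥0∞) * (μ : ℝ≥0∞) ^ p
      ≤ ∑' j, (S j).indicator (fun μ => (singularMultiplicity T μ : ℝ≥0∞) * (t j : ℝ≥0∞) ^ p) μ := by
    intro μ
    rcases eq_or_ne μ 0 with rfl | hμ
    · simp [ENNReal.zero_rpow_of_pos hp]
    have hμ' : 0 < μ := pos_iff_ne_zero.mpr hμ
    by_cases h0 : t 0 < μ
    · have : singularMultiplicity T μ = 0 := by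
        have := hcount 0 {μ} (by simpa using h0)
        simpa [hN0] using this
      simp [this]
    · classical
      have hex : ∃ j, t j < μ := (ht.eventually_lt_const hμ').exists
      obtain ⟨k, hk⟩ : ∃ k, Nat.find hex = k + 1 := by
        refine Nat.exists_eq_succ_of_ne_zero fun h => h0 ?_
        have := Nat.find_spec hex
        rwa [h] at this
      have h1 : t (k + 1) < μ := hk ▸ Nat.find_spec hex
      have h2 : μ ≤ t k := not_lt.mp (Nat.find_min hex (by omega))
      refine le_trans ?_ (ENNReal.le_tsum k)
      rw [Set.indicator_of_mem (show μ ∈ S k from ⟨h1, h2⟩)]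
      gcongr
  refine (ENNReal.tsum_le_tsum hpt).trans ?_
  rw [ENNReal.tsum_comm]
  refine ENNReal.tsum_le_tsum fun j => ?_
  classical
  rw [ENNReal.tsum_eq_iSup_sum]
  refine iSup_le fun s => ?_
  rw [Finset.sum_indicator_eq_sum_filter, ← Finset.sum_mul]
  gcongr
  have := hcount (j + 1) (s.filter fun μ => μ ∈ S j) fun μ hμ => (Finset.mem_filter.mp hμ).2.1
  exact_mod_cast this

end SchattenNorm

/-! ### Diagonalizing block by block -/

section DiagonalApproximation

variable {H : Type*} [NormedAddCommGroup H] [InnerProductSpace ℂ H]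

section BlockDiagonal

theorem orthogonalFamily_inf_orthogonal {V : ℕ → Submodule ℂ H} (hmono : Monotone V) :
    OrthogonalFamily ℂ (fun j => (V (j + 1) ⊓ (V j)ᗮ : Submodule ℂ H))
      fun j => (V (j + 1) ⊓ (V j)ᗮ).subtypeₗᵢ := by
  have h : ∀ i j, i < j → ∀ x ∈ V (i + 1) ⊓ (V i)ᗮ, ∀ y ∈ V (j + 1) ⊓ (V j)ᗮ, ⟪x, y⟫ = 0 :=
    fun i j hij x hx y hy => hy.2 x (hmono hij hx.1)
  intro i j hij x y
  rcases hij.lt_or_gt with hlt | hlt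
  · exact h i j hlt x x.2 y y.2
  · exact inner_eq_zero_symm.mp (h j i hlt y y.2 x x.2)

theorem le_of_inf_orthogonal_le {V : ℕ → Submodule ℂ H} (hmono : Monotone V) (h0 : V 0 = ⊥)
    [∀ j, FiniteDimensional ℂ (V j)] {W : Submodule ℂ H} (hW : ∀ j, V (j + 1) ⊓ (V j)ᗮ ≤ W) (j : ℕ) :
    V j ≤ W := by
  induction j with
  | zero => rw [h0]; exact bot_le
  | succ j ih =>
    rw [← Submodule.sup_orthogonal_inf_of_hasOrthogonalProjection (hmono (Nat.le_succ j))]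
    exact sup_le ih (by rw [inf_comm]; exact hW j)

/-- A symmetric antilinear operator, with almost invariant finite-dimensional subspaces exhausting
the space, is approximated by a diagonal one. -/
theorem exists_diagonal_approx [CompleteSpace H] {C : H →L⋆[ℂ] H}
    (hC : ∀ x y, ⟪C x, y⟫ = ⟪C y, x⟫) {V : ℕ → Submodule ℂ H} (hmono : Monotone V) (h0 : V 0 = ⊥)
    [∀ j, FiniteDimensional ℂ (V j)] (hdense : ⊤ ≤ (⨆ j, V j).topologicalClosure) {θ : ℝ}
    (hθ : 0 ≤ θ) (hV : ∀ j, ∀ x ∈ V j, ∃ y ∈ V j, ‖C x - y‖ ≤ θ / 2 ^ j * ‖x‖) :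
    ∃ (ι : Type) (_ : Countable ι) (e : HilbertBasis ι ℂ H) (c : ι → ℂ), (∀ i, ‖c i‖ ≤ ‖C‖) ∧
      ∀ K : H →L⋆[ℂ] H, (∀ i, K (e i) = C (e i) - c i • e i) →
        ∀ j, ∀ x ∈ (V j)ᗮ, ‖K x‖ ≤ 3 * θ / 2 ^ j * ‖x‖ := by
  let M : ℕ → Submodule ℂ H := fun j => V (j + 1) ⊓ (V j)ᗮ
  have hMfin : ∀ j, FiniteDimensional ℂ (M j) := fun j =>
    Submodule.finiteDimensional_of_le (inf_le_left : M j ≤ V (j + 1))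
  -- The compression of `C` to a block is again symmetric, so Takagi applies to it.
  let T : ∀ j, M j →ₗ⋆[ℂ] M j := fun j =>
    ((M j).orthogonalProjectionOnto : H →ₗ[ℂ] M j).comp ((C : H →ₗ⋆[ℂ] H).comp (M j).subtype)
  have hT : ∀ j (x y : M j), ⟪T j x, y⟫ = ⟪T j y, x⟫ := by
    intro j x y
    have h1 : ∀ x y : M j, ⟪T j x, y⟫ = ⟪C x, (y : H)⟫ := fun x y =>
      Submodule.inner_orthogonalProjectionOnto_eq_of_mem_right y (C x)
    rw [h1, h1, hC]
  choose b c hb using fun j => exists_orthonormalBasis_eigenvectors (hT j)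
  have hbP : ∀ j i, (M j).starProjection (C (b j i)) = c j i • (b j i : H) := fun j i =>
    congrArg Subtype.val (hb j i)
  let v : (Σ j, Fin (Module.finrank ℂ (M j))) → H := fun a => (b a.1 a.2 : H)
  have hv : Orthonormal ℂ v :=
    (orthogonalFamily_inf_orthogonal hmono).orthonormal_sigma_orthonormal fun j => (b j).orthonormal
  have hMspan : ∀ j, M j = Submodule.span ℂ (Set.range fun i => (b j i : H)) := by
    intro j
    have h1 := congrArg (Submodule.map (M j).subtype) (b j).toBasis.span_eq
    rw [Submodule.map_span, Submodule.map_subtype_top, ← Set.range_comp] at h1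
    refine h1.symm.trans ?_
    simp [Function.comp_def]
  have hvspan : ⊤ ≤ (Submodule.span ℂ (Set.range v)).topologicalClosure := by
    refine hdense.trans (Submodule.topologicalClosure_mono (iSup_le ?_))
    refine le_of_inf_orthogonal_le hmono h0 fun j => ?_
    change M j ≤ _
    rw [hMspan j]
    refine Submodule.span_mono ?_
    rintro _ ⟨i, rfl⟩
    exact ⟨⟨j, i⟩, rfl⟩
  refine ⟨_, inferInstance, HilbertBasis.mk hv hvspan, fun a => c a.1 a.2, ?_, ?_⟩
  · rintro ⟨j, i⟩
    have h1 : ‖(b j i : H)‖ = 1 := hv.1 ⟨j, i⟩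
    have h2 : ‖c j i‖ = ‖(M j).starProjection (C (b j i))‖ := by
      rw [hbP, norm_smul, h1, mul_one]
    rw [h2]
    refine (Submodule.norm_starProjection_apply_le _ _).trans ?_
    simpa [h1] using C.le_opNorm (b j i : H)
  intro K hK
  simp only [HilbertBasis.coe_mk] at hK
  have hKM : ∀ j, ∀ x ∈ M j, K x = C x - (M j).starProjection (C x) := by
    intro j x hx
    rw [hMspan j] at hx
    refine Submodule.span_induction ?_ ?_ ?_ ?_ hx
    · rintro _ ⟨i, rfl⟩
      rw [hbP]
      exact hK ⟨j, i⟩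
    · simp
    · intro x y _ _ hx hy
      simp only [map_add, hx, hy]
      abel
    · intro a x _ hx
      simp only [map_smulₛₗ, hx, smul_sub]
      simp
  have hpos : ∀ j : ℕ, 0 ≤ θ / 2 ^ j := fun j => by positivity
  -- `C x` leaves the block either out of `V (j + 1)`, costing `θ / 2 ^ (j + 1)`, or into `V j`,
  -- costing `θ / 2 ^ j`. The total `3θ / 2 ^ (j + 1)` is written as a difference so that the sum
  -- over blocks telescopes.
  have hKM' : ∀ j, ∀ x ∈ M j, ‖K x‖ ≤ 3 * (θ / 2 ^ j - θ / 2 ^ (j + 1)) * ‖x‖ := by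
    intro j x hx
    obtain ⟨y, hy, hxy⟩ := hV (j + 1) x hx.1
    have h1 := (norm_sub_starProjection_le (V (j + 1)) (C x) hy).trans hxy
    have h2 := norm_starProjection_le_of_mem_orthogonal hC (hpos j) (hV j) hx.2
    have h3 : K x = (C x - (V (j + 1)).starProjection (C x)) + (V j).starProjection (C x) := by
      rw [hKM j x hx, starProjection_inf_orthogonal (hmono (Nat.le_succ j))]
      abel
    rw [h3]
    refine (norm_add_le _ _).trans ((add_le_add h1 h2).trans_eq ?_)
    rw [pow_succ]
    field_simp
    ring
  intro j x hx
  have hind : ∀ m : ℕ, ‖K ((V (j + m)).starProjection x)‖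
      ≤ 3 * (θ / 2 ^ j - θ / 2 ^ (j + m)) * ‖x‖ := by
    intro m
    induction m with
    | zero =>
      have : (V j).starProjection x = 0 := (V j).eq_starProjection_of_mem_orthogonal
        (V j).zero_mem (by simpa using hx)
      simp [this]
    | succ m ih =>
      have h1 : (V (j + (m + 1))).starProjection x
          = (V (j + m)).starProjection x + (M (j + m)).starProjection x := by
        rw [starProjection_inf_orthogonal (hmono (Nat.le_succ (j + m)))]
        simp [add_assoc]
      rw [h1, map_add]
      refine (norm_add_le _ _).trans ?_
      have h2 := hKM' (j + m) _ ((M (j + m)).starProjection_apply_mem x)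
      have h3 : 0 ≤ θ / 2 ^ (j + m) - θ / 2 ^ (j + m + 1) := by
        have : θ / 2 ^ (j + m) - θ / 2 ^ (j + m + 1) = θ / 2 ^ (j + m + 1) := by
          rw [pow_succ]; field_simp; ring
        rw [this]
        exact hpos _
      have h4 : 3 * (θ / 2 ^ (j + m) - θ / 2 ^ (j + m + 1)) * ‖(M (j + m)).starProjection x‖
          ≤ 3 * (θ / 2 ^ (j + m) - θ / 2 ^ (j + m + 1)) * ‖x‖ := by
        have := (M (j + m)).norm_starProjection_apply_le x
        gcongr
      rw [← add_assoc]
      linarith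
  -- The projections onto `V (j + m)` converge strongly to the identity, which carries the bound to
  -- all of `(V j)ᗮ`.
  have hlim := (Submodule.starProjection_tendsto_self V hmono x hdense).comp
    (Filter.tendsto_add_atTop_nat j)
  have hlim' := ((K.continuous.tendsto x).comp hlim).norm
  refine le_of_tendsto hlim' (Filter.Eventually.of_forall fun m => ?_)
  have := hind m
  simp only [Function.comp_apply, add_comm m j]
  refine this.trans ?_
  have := hpos (j + m)
  gcongr
  rw [mul_div_assoc]
  linarith

end BlockDiagonal

section Diagonal

variable {ι : Type*} (e : HilbertBasis ι ℂ H)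

/-- Antilinear diagonal operators with bounded diagonal. -/
theorem exists_antilinear_diagonal {c : ι → ℂ} {B : ℝ} (hB : 0 ≤ B) (hc : ∀ i, ‖c i‖ ≤ B) :
    ∃ L : H →L⋆[ℂ] H, (∀ i, L (e i) = c i • e i) ∧ ∀ x, ‖L x‖ ≤ B * ‖x‖ := by
  classical
  have h2 : (0 : ℝ) < (2 : ℝ≥0∞).toReal := by norm_num
  have hle : ∀ (f : ι → ℂ) i, ‖c i * (starRingEnd ℂ) (f i)‖ ≤ B * ‖f i‖ := by
    intro f i
    rw [norm_mul, RCLike.norm_conj]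
    exact mul_le_mul_of_nonneg_right (hc i) (norm_nonneg _)
  have hmem : ∀ f : lp (fun _ : ι => ℂ) 2, Memℓp (fun i => c i * (starRingEnd ℂ) (f i)) 2 := by
    intro f
    refine memℓp_gen (Summable.of_nonneg_of_le (fun i => by positivity) (fun i => ?_)
      (((lp.memℓp f).summable h2).mul_left (B ^ (2 : ℝ≥0∞).toReal)))
    rw [← Real.mul_rpow hB (norm_nonneg _)]
    exact Real.rpow_le_rpow (norm_nonneg _) (hle f i) h2.le
  let L₀ : lp (fun _ : ι => ℂ) 2 →ₗ⋆[ℂ] lp (fun _ : ι => ℂ) 2 :=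
    { toFun := fun f => ⟨fun i => c i * (starRingEnd ℂ) (f i), hmem f⟩
      map_add' := fun f g => by
        ext i
        simp [mul_add]
        rfl
      map_smul' := fun a f => by
        ext i
        simp [mul_left_comm] }
  have hL₀ : ∀ f, ‖L₀ f‖ ≤ B * ‖f‖ := by
    intro f
    refine lp.norm_le_of_forall_sum_le h2 (by positivity) fun s => ?_
    rw [Real.mul_rpow hB (norm_nonneg _)]
    calc ∑ i ∈ s, ‖L₀ f i‖ ^ (2 : ℝ≥0∞).toReal
        ≤ ∑ i ∈ s, B ^ (2 : ℝ≥0∞).toReal * ‖f i‖ ^ (2 : ℝ≥0∞).toReal := by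
          refine Finset.sum_le_sum fun i _ => ?_
          rw [← Real.mul_rpow hB (norm_nonneg _)]
          exact Real.rpow_le_rpow (norm_nonneg _) (hle f i) h2.le
      _ ≤ _ := by
          rw [← Finset.mul_sum]
          exact mul_le_mul_of_nonneg_left (lp.sum_rpow_le_norm_rpow h2 f s) (by positivity)
  let L₁ : H →ₗ⋆[ℂ] H :=
    (e.repr.symm.toLinearEquiv : lp (fun _ : ι => ℂ) 2 →ₗ[ℂ] H).comp
      (L₀.comp (e.repr.toLinearEquiv : H →ₗ[ℂ] lp (fun _ : ι => ℂ) 2))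
  have hL₁ : ∀ x, L₁ x = e.repr.symm (L₀ (e.repr x)) := fun _ => rfl
  have hbound : ∀ x, ‖L₁ x‖ ≤ B * ‖x‖ := by
    intro x
    rw [hL₁, LinearIsometryEquiv.norm_map]
    simpa using hL₀ (e.repr x)
  refine ⟨L₁.mkContinuous B hbound, fun i => ?_, hbound⟩
  change L₁ (e i) = _
  rw [hL₁, e.repr_self, LinearIsometryEquiv.symm_apply_eq, map_smul, e.repr_self]
  ext k
  change c k * (starRingEnd ℂ) (lp.single (E := fun _ : ι => ℂ) 2 i (1 : ℂ) k)
    = c i * lp.single (E := fun _ : ι => ℂ) 2 i (1 : ℂ) k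
  rcases eq_or_ne k i with rfl | hk
  · simp
  · simp [hk]

end Diagonal

end DiagonalApproximation

/-! ### From `τ S` to `D κ`, and the choice of mesh -/

section ComplexSymmetricOperators

variable {H : Type*} [NormedAddCommGroup H] [InnerProductSpace ℂ H]

/-- Polarization; moving `I` through `κ` changes its sign, which exchanges the two arguments. -/
theorem IsAntiunitary.inner_map_map {κ : H →L⋆[ℂ] H} (hκ : IsAntiunitary κ) (x y : H) :
    ⟪κ x, κ y⟫ = ⟪y, x⟫ := by
  have h1 : ∀ z, Complex.I • κ z = κ (-(Complex.I • z)) := by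
    intro z
    rw [map_neg, map_smulₛₗ]
    simp
  have h2 : ‖x + Complex.I • y‖ = ‖y - Complex.I • x‖ := by
    have : x + Complex.I • y = Complex.I • (y - Complex.I • x) := by
      rw [smul_sub, smul_smul, Complex.I_mul_I]
      module
    rw [this, norm_smul]
    simp
  have h3 : ‖x - Complex.I • y‖ = ‖y + Complex.I • x‖ := by
    have : x - Complex.I • y = -(Complex.I • (y + Complex.I • x)) := by
      rw [smul_add, smul_smul, Complex.I_mul_I]
      module
    rw [this, norm_neg, norm_smul]
    simp
  rw [inner_eq_sum_norm_sq_div_four, inner_eq_sum_norm_sq_div_four]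
  simp only [RCLike.I_to_complex]
  rw [h1, ← map_add, ← map_sub, ← map_add, ← map_sub, hκ.2, hκ.2, hκ.2, hκ.2, sub_neg_eq_add,
    ← sub_eq_add_neg, h2, h3, add_comm x y, norm_sub_rev x y]

/-- The modulus of the antilinear operator `τ S`. -/
theorem IsComplexSymmetric.exists_isModulus [CompleteSpace H] {τ : H →L⋆[ℂ] H} {S : H →L[ℂ] H}
    (h : IsComplexSymmetric τ S) : ∃ A, IsModulus (τ.comp S) A ∧ ‖A‖ ≤ ‖S‖ := by
  have hττ : ∀ x, τ (τ x) = x := h.conjugation.conjugation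
  have hinner := h.conjugation.unitary.inner_map_map
  have hS : ∀ x, τ (ContinuousLinearMap.adjoint S (τ x)) = S x := fun x =>
    congrArg (fun T : H →L[ℂ] H => T x) h.symm
  have hS' : ∀ x, τ (S (τ x)) = ContinuousLinearMap.adjoint S x := by
    intro x
    rw [← hS, hττ, hττ]
  let N : H →L[ℂ] H := star S * S
  have hN : 0 ≤ N := star_mul_self_nonneg S
  have hNsa : IsSelfAdjoint N := .of_nonneg hN
  -- `C² = τ S τ S = S* S`; in particular `C` commutes with `N`, hence with its square root.
  have hCC : ∀ x, τ.comp S (τ.comp S x) = N x := fun x => hS' (S x)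
  let A : H →L[ℂ] H := cfc Real.sqrt N
  have hAA : A * A = N := by
    have e : (spectrum ℝ N).EqOn (fun t => Real.sqrt t * Real.sqrt t) id := fun t ht =>
      Real.mul_self_sqrt (spectrum_nonneg_of_nonneg hN ht)
    rw [← cfc_mul _ _ N (by fun_prop) (by fun_prop), cfc_congr e, cfc_id ℝ N hNsa]
  have hmod : IsModulus (τ.comp S) A :=
    { symm := fun x y => by
        have h1 : ∀ x y, ⟪τ (S x), y⟫ = ⟪τ y, S x⟫ := fun x y => by
          conv_lhs => rw [← hττ y]
          exact hinner _ _
        change ⟪τ (S x), y⟫ = ⟪τ (S y), x⟫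
        rw [h1, h1, ← hS x, hinner, ContinuousLinearMap.adjoint_inner_left]
      nonneg := cfc_nonneg fun t _ => Real.sqrt_nonneg t
      comm := antilinear_comm_cfc hNsa (fun x => by rw [← hCC, ← hCC]) Real.sqrt
      sq := fun x => by rw [hCC, ← mul_apply_eq_comp, hAA] }
  refine ⟨A, hmod, A.opNorm_le_bound (norm_nonneg _) fun x => ?_⟩
  rw [← hmod.norm_apply]
  exact (h.conjugation.unitary.2 _).trans_le (S.le_opNorm x)

/-- An antilinear diagonal operator is `D κ` with `κ` a unitary conjugation and `D` non-negative,
both diagonal. -/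
theorem exists_conjugation_diagonal {ι : Type*} (e : HilbertBasis ι ℂ H) {c : ι → ℂ} {B : ℝ}
    (hB : 0 ≤ B) (hc : ∀ i, ‖c i‖ ≤ B) : ∃ (κ : H →L⋆[ℂ] H) (D : H →L[ℂ] H),
      IsUnitaryConjugation κ ∧ IsDiagonalWrt κ e ∧ IsNonnegDiagonalWrt D e ∧
      ∀ i, D (κ (e i)) = c i • e i := by
  -- A unimodular phase even where `c i = 0`, so that `κ` is isometric; `κ² = 1` on the basis
  -- because `κ` conjugates `ph i`.
  let ph : ι → ℂ := fun i => if c i = 0 then 1 else c i / ‖c i‖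
  have hph : ∀ i, ‖ph i‖ = 1 := by
    intro i
    simp only [ph]
    split_ifs with h
    · simp
    · simp [h]
  have hphc : ∀ i, ph i * ‖c i‖ = c i := by
    intro i
    simp only [ph]
    split_ifs with h
    · simp [h]
    · have : (‖c i‖ : ℂ) ≠ 0 := by simpa using h
      field_simp
  obtain ⟨κ, hκ, hκn⟩ := exists_antilinear_diagonal e zero_le_one (fun i => (hph i).le)
  -- The linear `D` is obtained as a product of two antilinear diagonal operators, `κ₀` being
  -- conjugation of the coordinates.
  obtain ⟨κ₀, hκ₀, -⟩ := exists_antilinear_diagonal (c := fun _ => 1) e zero_le_one (by simp)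
  obtain ⟨D₀, hD₀, -⟩ := exists_antilinear_diagonal (c := fun i => (‖c i‖ : ℂ)) e hB
    (by simpa using hc)
  have hκκ : ∀ x, κ (κ x) = x := by
    have h1 : κ.comp κ = ContinuousLinearMap.id ℂ H := by
      refine ContinuousLinearMap.ext_on (s := Set.range e) ?_ ?_
      · have := e.dense_span
        rw [Submodule.dense_iff_topologicalClosure_eq_top]
        exact this
      · rintro _ ⟨i, rfl⟩
        change κ (κ (e i)) = e i
        rw [hκ, map_smulₛₗ, hκ, smul_smul, mul_comm, Complex.mul_conj, Complex.normSq_eq_norm_sq,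
          hph]
        simp
    exact fun x => congrArg (fun T : H →L[ℂ] H => T x) h1
  have hiso : ∀ x, ‖κ x‖ = ‖x‖ := fun x =>
    le_antisymm (by simpa using hκn x) (by simpa [hκκ] using hκn (κ x))
  have hD : ∀ i, D₀.comp κ₀ (e i) = ((‖c i‖ : ℝ) : ℂ) • e i := by
    intro i
    change D₀ (κ₀ (e i)) = _
    rw [hκ₀, one_smul, hD₀]
  refine ⟨κ, D₀.comp κ₀, ⟨hκκ, Function.Involutive.bijective hκκ, hiso⟩, ⟨ph, hκ⟩,
    ⟨fun i => ‖c i‖, fun i => norm_nonneg _, hD⟩, fun i => ?_⟩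
  rw [hκ, map_smul, hD, smul_smul, hphc]

/-- The `p`-th power sum governing the Schatten norm tends to zero as the mesh gets finer. -/
theorem exists_mesh {c p ε : ℝ} (hc : 0 < c) (hp : 1 < p) (hε : 0 < ε) :
    ∃ m : ℕ, m ≠ 0 ∧
      (∑' j : ℕ, (((j + 1) * (1 + 2 * (2 ^ (j + 1) * m)) : ℕ) : ℝ≥0∞) *
        ((3 * (c / m) / 2 ^ j).toNNReal : ℝ≥0∞) ^ p) ^ (1 / p) < ENNReal.ofReal ε := by
  have hp0 : 0 < p := zero_lt_one.trans hp
  -- Ratio of the geometric factor: dimensions double while `p`-th powers of errors shrink by `2 ^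
  -- p`. It is below `1` because `p > 1`.
  set r : ℝ := 2 * (2 ^ p)⁻¹ with hr
  have hr1 : r < 1 := by
    rw [hr, ← div_eq_mul_inv, div_lt_one (by positivity)]
    exact Real.self_lt_rpow_of_one_lt one_lt_two hp
  have hr0 : 0 ≤ r := by positivity
  have hsum : Summable fun j : ℕ => ((j : ℝ) + 1) * r ^ j := by
    have h1 := summable_pow_mul_geometric_of_norm_lt_one 1
      (show ‖r‖ < 1 by rwa [Real.norm_of_nonneg hr0])
    have h2 := summable_geometric_of_lt_one hr0 hr1
    simpa [add_mul] using h1.add h2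
  set K : ℝ := 5 * (3 * c) ^ p * ∑' j : ℕ, ((j : ℝ) + 1) * r ^ j with hK
  have hlim : Filter.Tendsto (fun m : ℕ => (m : ℝ) ^ (1 - p) * K) Filter.atTop (nhds 0) := by
    have h1 := (tendsto_rpow_neg_atTop (sub_pos.mpr hp)).comp tendsto_natCast_atTop_atTop
    simpa using h1.mul_const K
  obtain ⟨m, hm, hm1⟩ := ((hlim.eventually_lt_const (Real.rpow_pos_of_pos hε p)).and
    (Filter.eventually_ge_atTop 1)).exists
  have hm0 : (0 : ℝ) < m := by exact_mod_cast hm1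
  refine ⟨m, by omega, ?_⟩
  have hterm : ∀ j : ℕ, (((j + 1) * (1 + 2 * (2 ^ (j + 1) * m)) : ℕ) : ℝ≥0∞) *
      ((3 * (c / m) / 2 ^ j).toNNReal : ℝ≥0∞) ^ p
      ≤ ENNReal.ofReal ((m : ℝ) ^ (1 - p) * (5 * (3 * c) ^ p) * (((j : ℝ) + 1) * r ^ j)) := by
    intro j
    have ht : 0 ≤ 3 * (c / m) / 2 ^ j := by positivity
    have e1 : ((3 * (c / m) / 2 ^ j).toNNReal : ℝ≥0∞) ^ p
        = ENNReal.ofReal ((3 * (c / m) / 2 ^ j) ^ p) :=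
      ENNReal.ofReal_rpow_of_nonneg ht hp0.le
    rw [e1, ← ENNReal.ofReal_natCast, ← ENNReal.ofReal_mul (by positivity)]
    refine ENNReal.ofReal_le_ofReal ?_
    have e2 : (3 * (c / m) / 2 ^ j) ^ p = (3 * c) ^ p * (m : ℝ) ^ (-p) * ((2 ^ p)⁻¹) ^ j := by
      rw [Real.div_rpow (by positivity) (by positivity), ← mul_div_assoc,
        Real.div_rpow (by positivity) hm0.le, Real.rpow_neg hm0.le, inv_pow,
        ← Real.rpow_natCast (2 ^ p) j, ← Real.rpow_natCast 2 j, ← Real.rpow_mul zero_le_two,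
        ← Real.rpow_mul zero_le_two, mul_comm p]
      field_simp
    have e3 : (m : ℝ) ^ (1 - p) = m * (m : ℝ) ^ (-p) := by
      rw [sub_eq_add_neg, Real.rpow_add hm0, Real.rpow_one]
    -- The `5` is `1 + 4`, using `1 ≤ 2 ^ j * m`.
    have h5 : (((j + 1) * (1 + 2 * (2 ^ (j + 1) * m)) : ℕ) : ℝ)
        ≤ ((j : ℝ) + 1) * (5 * (2 ^ j * m)) := by
      have h6 : (1 : ℝ) ≤ 2 ^ j * m := by
        have : (1 : ℝ) ≤ m := by exact_mod_cast hm1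
        exact one_le_mul_of_one_le_of_one_le (one_le_pow₀ one_le_two) this
      push_cast
      rw [pow_succ]
      refine mul_le_mul_of_nonneg_left ?_ (by positivity)
      linarith
    refine (mul_le_mul_of_nonneg_right h5 (by positivity)).trans_eq ?_
    rw [e2, e3, hr, mul_pow]
    ring
  have hnn : ∀ j : ℕ, 0 ≤ (m : ℝ) ^ (1 - p) * (5 * (3 * c) ^ p) * (((j : ℝ) + 1) * r ^ j) :=
    fun j => by positivity
  have htotal := (ENNReal.tsum_le_tsum hterm).trans_eq
    (ENNReal.ofReal_tsum_of_nonneg hnn (hsum.mul_left _)).symm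
  rw [tsum_mul_left, mul_assoc, ← hK] at htotal
  refine (ENNReal.rpow_le_rpow htotal (by positivity)).trans_lt ?_
  rw [one_div, ENNReal.rpow_inv_lt_iff hp0, ENNReal.ofReal_rpow_of_pos hε]
  exact (ENNReal.ofReal_lt_ofReal_iff (Real.rpow_pos_of_pos hε p)).mpr hm

end ComplexSymmetricOperators

end ComplexSymmetric

end

/-! ### Assembly of the theorem -/

theorem mainTheorem8 {H : Type*} [NormedAddCommGroup H] [InnerProductSpace ℂ H]
    [CompleteSpace H] [TopologicalSpace.SeparableSpace H]
    (τ : H →L⋆[ℂ] H) (S : H →L[ℂ] H) (hS : ComplexSymmetric.IsComplexSymmetric τ S)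
    (p : ℝ) (hp : 1 < p) (ε : ℝ) (hε : 0 < ε) :
    ∃ (κ : H →L⋆[ℂ] H) (D : H →L[ℂ] H) (ι : Type) (_ : Countable ι) (e : HilbertBasis ι ℂ H),
      ComplexSymmetric.IsUnitaryConjugation κ ∧
      ComplexSymmetric.IsDiagonalWrt κ e ∧
      ComplexSymmetric.IsNonnegDiagonalWrt D e ∧
      ComplexSymmetric.schattenNorm p (S - τ.comp (D.comp κ)) < ENNReal.ofReal ε := by
  obtain ⟨A, hA, hAS⟩ := hS.exists_isModulus
  have hτ := hS.conjugation
  -- The added `1` keeps the mesh positive when `S = 0`.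
  have hc : 0 < ‖S‖ + 1 := by positivity
  obtain ⟨m, hm, hsum⟩ := ComplexSymmetric.exists_mesh hc hp hε
  obtain ⟨V, hmono, h0, hf, hfin, hdim, hV⟩ := hA.exists_almost_invariant hc (by linarith) hm
    (TopologicalSpace.denseSeq H)
  have hdense : ⊤ ≤ (⨆ j, V j).topologicalClosure := by
    refine (TopologicalSpace.denseRange_denseSeq H).closure_eq.ge.trans (closure_mono ?_)
    rintro _ ⟨i, rfl⟩
    exact Submodule.mem_iSup_of_mem (i + 1) (hf i)
  obtain ⟨ι, hι, e, c, hcb, hK⟩ := ComplexSymmetric.exists_diagonal_approx hA.symm hmono h0 hdense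
    (by positivity) hV
  obtain ⟨κ, D, hκ, hκe, hDe, hDκ⟩ :=
    ComplexSymmetric.exists_conjugation_diagonal e (norm_nonneg (τ.comp S)) hcb
  refine ⟨κ, D, ι, hι, e, hκ, hκe, hDe, lt_of_le_of_lt ?_ hsum⟩
  have hKV := hK (τ.comp S - D.comp κ) fun i => by
    rw [← hDκ]
    rfl
  set T : H →L[ℂ] H := S - τ.comp (D.comp κ) with hT
  -- As `τ² = 1`, `T = τ (C - D κ)`, and `τ` is isometric.
  have hTn : ∀ x, ‖T x‖ = ‖(τ.comp S - D.comp κ) x‖ := by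
    intro x
    have : T x = τ ((τ.comp S - D.comp κ) x) := by
      change S x - τ (D (κ x)) = τ (τ (S x) - D (κ x))
      rw [map_sub, hτ.conjugation]
    rw [this, hτ.unitary.2]
  -- The first summand has rank at most `dim V j`; the second is small by the bound on `(V j)ᗮ`.
  have hsplit : ∀ j, T = T ∘L (V j).starProjection + T ∘L (V j)ᗮ.starProjection := by
    intro j
    ext x
    simp [Submodule.starProjection_orthogonal_val]
  have hrange : ∀ j, (T ∘L (V j).starProjection).range ≤ (V j).map (T : H →ₗ[ℂ] H) := by
    rintro j _ ⟨x, rfl⟩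
    exact ⟨_, (V j).starProjection_apply_mem x, rfl⟩
  refine ComplexSymmetric.schattenNorm_le_of_approx
    (N := fun j => j * (1 + 2 * (2 ^ j * m)))
    (t := fun j => (3 * ((‖S‖ + 1) / m) / 2 ^ j).toNNReal) hsplit
    (fun j => Submodule.finiteDimensional_of_le (hrange j))
    (fun j => ((Submodule.finrank_mono (hrange j)).trans (Submodule.finrank_map_le _ _)).trans
      (hdim j)) (by simp) (fun j => ?_) ?_ (zero_lt_one.trans hp)
  · refine ContinuousLinearMap.opNorm_le_bound _ NNReal.zero_le_coe fun x => ?_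
    rw [Real.coe_toNNReal _ (by positivity)]
    change ‖T ((V j)ᗮ.starProjection x)‖ ≤ _
    rw [hTn]
    refine (hKV j _ ((V j)ᗮ.starProjection_apply_mem x)).trans ?_
    have := (V j)ᗮ.norm_starProjection_apply_le x
    gcongr
  · rw [← Real.toNNReal_zero]
    refine tendsto_real_toNNReal ?_
    simp only [div_eq_mul_inv _ ((2 : ℝ) ^ _), ← inv_pow]
    simpa using (tendsto_pow_atTop_nhds_zero_of_lt_one (r := (2 : ℝ)⁻¹) (by norm_num)
      (by norm_num)).const_mul (3 * ((‖S‖ + 1) / m))
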